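/- **Setting.** Let $\rho\in\mathbb R^p$ be parameters and let $q,v\in\mathbb R^n$ be generalized positions and velocities. Before ($-$) and after ($+$) an event a constrained multibody system is described by smooth mass matrices $\mathsf M^\pm(t,q,\rho)\in\mathbb R^{n\times n}$, smooth forces $\mathsf F^\pm(t,q,v,\rho)\in\mathbb R^n$ and smooth position constraint functions $\Phi^\pm(t,q,\rho)\in\mathbb R^{m^\pm}$ (possibly different, also in number), through $$\dot q=v,\qquad \mathsf M^\pm\dot v=\mathsf F^\pm+(\Phi^\pm_q)^{\rm T}\lambda,\qquad \Phi^\pm(t,q,\rho)=0 .$$ The coordinates are partitioned, up to permutations fixed before and after the event, into dependent components (dep$\pm$, $m^\pm$ of them) and independent components (dof$\pm$, $f^\pm=n-m^\pm$ of them). $\Phi^\pm_{q_{\rm dep\pm}}$ and $\Phi^\pm_{q_{\rm dof\pm}}$ are the corresponding column blocks of $\Phi^\pm_q$, and $\mathsf R^\pm=-(\Phi^\pm_{q_{\rm dep\pm}})^{-1}\Phi^\pm_{q_{\rm dof\pm}}$. Let $r:\mathbb R^n\to\mathbb R$ be a smooth event function and $h:\mathbb R^{1+n+f^-+p}\to\mathbb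 R^{f^+}$ a smooth jump function. For all parameters near a given $\rho$, let $q(t,\rho),v(t,\rho)$, $t_0\le t\le t_F$, be a hybrid trajectory with continuously differentiable initial data $q(t_0,\rho)=q_0(\rho)$, $v(t_0,\rho)=v_0(\rho)$ and exactly one event, at a time $t_{\rm eve}(\rho)\in(t_0,t_F)$: the system "$-$" governs $t<t_{\rm eve}$ and the system "$+$" governs $t>t_{\rm eve}$; $t_{\rm eve}(\rho)$ is the first time in $[t_0,t_F]$ at which $r(q(t,\rho))=0$; $q$ is continuous on $[t_0,t_F]$, and $q|_{t_{\rm eve}}$ satisfies both position constraints; $v$ is continuous on $[t_0,t_{\rm eve})$ and $(t_{\rm eve},t_F]$, with one-sided limits $v|^-_{t_{\rm eve}},v|^+_{t_{\rm eve}}$ at the event such that $v_{\rm dof+}|^+_{t_{\rm eve}}=h(t_{\rm eve},q|_{t_{\rm eve}},v_{\rm dof-}|^-_{t_{\rm eve}},\rho)$ and $\Phi^+_q\,v|^+_{t_{\rm eve}}=-\Phi^+_t$ at $(t_{\rm eve},q|_{t_{\rm eve}},\rho)$. Assume that at the given $\rho$ the matrix $\begin{bmatrix}\mathsf M^\pm&(\Phi_q^\pm)^{\rm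 T}\\ \Phi^\pm_q&0\end{bmatrix}$ is nonsingular along the trajectory (with $-$ on $[t_0,t_{\rm eve}]$ and $+$ on $[t_{\rm eve},t_F]$), that $\Phi^\pm_{q_{\rm dep\pm}}$ are nonsingular at the event, and that there is no grazing: $\frac{dr}{dq}(q|_{t_{\rm eve}})\cdot v|^-_{t_{\rm eve}}\neq0$. **Theorem 6 (jump in position sensitivity for constrained systems).** At the given $\rho$, $t_{\rm eve}$ is differentiable, the position sensitivity $Q(t,\rho)=\frac{dq}{d\rho}(t,\rho)\in\mathbb R^{n\times p}$ exists for all $t\in[t_0,t_F]\setminus\{t_{\rm eve}\}$, and the one-sided limits $Q|^\pm_{t_{\rm eve}}=\lim_{t\to t_{\rm eve}^\pm}Q(t,\rho)$ exist. The independent components right after the event are $$Q_{\rm dof+}|^+_{t_{\rm eve}}=Q_{\rm dof+}|^-_{t_{\rm eve}}-\Big(v_{\rm dof+}|^+_{t_{\rm eve}}-v_{\rm dof+}|^-_{t_{\rm eve}}\Big)\cdot\frac{dt_{\rm eve}}{d\rho},$$ and the dependent components right after the event are $$Q_{\rm dep+}|^+_{t_{\rm eve}}=\mathsf R^+\cdot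 Q_{\rm dof+}|^+_{t_{\rm eve}}-\big(\Phi^+_{q_{\rm dep+}}\big)^{-1}\Phi^+_\rho ,$$ with $\mathsf R^+$, $\Phi^+_{q_{\rm dep+}}$ and $\Phi^+_\rho$ evaluated at $(t_{\rm eve},q|_{t_{\rm eve}},\rho)$. -/

import Mathlib

open Filter Topology
open scoped ContDiff

/-- The Jacobian matrix of `f : ℝᵃ → ℝᵇ` at `x`. -/
noncomputable def jacobianMatrix {a b : ℕ} (f : (Fin a → ℝ) → (Fin b → ℝ)) (x : Fin a → ℝ) :
    Matrix (Fin b) (Fin a) ℝ :=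
  LinearMap.toMatrix' (fderiv ℝ f x : (Fin a → ℝ) →ₗ[ℝ] (Fin b → ℝ))

/-- The data of a constrained multibody system with `n` generalized coordinates, `m` holonomic
constraints and `p` parameters: mass matrix `M(t, q, ρ)`, generalized force `F(t, q, v, ρ)` and
position constraint function `Φ(t, q, ρ)`, all smooth. -/
structure MultibodySystem (n m p : ℕ) where
  mass : ℝ → (Fin n → ℝ) → (Fin p → ℝ) → Matrix (Fin n) (Fin n) ℝ
  force : ℝ → (Fin n → ℝ) → (Fin n → ℝ) → (Fin p → ℝ) → (Fin n → ℝ)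
  constr : ℝ → (Fin n → ℝ) → (Fin p → ℝ) → (Fin m → ℝ)
  mass_smooth : ∀ i j, ContDiff ℝ ∞
    (fun x : ℝ × (Fin n → ℝ) × (Fin p → ℝ) => mass x.1 x.2.1 x.2.2 i j)
  force_smooth : ContDiff ℝ ∞
    (fun x : ℝ × (Fin n → ℝ) × (Fin n → ℝ) × (Fin p → ℝ) => force x.1 x.2.1 x.2.2.1 x.2.2.2)
  constr_smooth : ContDiff ℝ ∞
    (fun x : ℝ × (Fin n → ℝ) × (Fin p → ℝ) => constr x.1 x.2.1 x.2.2)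

namespace MultibodySystem

variable {n m f p : ℕ}

/-- The partial Jacobian `Φ_q(t, q, ρ)`. -/
noncomputable def constrQ (S : MultibodySystem n m p) (t : ℝ) (q : Fin n → ℝ) (ρ : Fin p → ℝ) :
    Matrix (Fin m) (Fin n) ℝ :=
  jacobianMatrix (fun x => S.constr t x ρ) q

/-- The partial Jacobian `Φ_ρ(t, q, ρ)`. -/
noncomputable def constrRho (S : MultibodySystem n m p) (t : ℝ) (q : Fin n → ℝ)
    (ρ : Fin p → ℝ) : Matrix (Fin m) (Fin p) ℝ :=
  jacobianMatrix (fun x => S.constr t q x) ρ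

/-- The partial derivative `Φ_t(t, q, ρ)`. -/
noncomputable def constrT (S : MultibodySystem n m p) (t : ℝ) (q : Fin n → ℝ) (ρ : Fin p → ℝ) :
    Fin m → ℝ :=
  deriv (fun s => S.constr s q ρ) t

/-- The matrix `[M, Φ_qᵀ; Φ_q, 0]` of the equations of motion in index-1 form. -/
noncomputable def augmentedMatrix (S : MultibodySystem n m p) (t : ℝ) (q : Fin n → ℝ)
    (ρ : Fin p → ℝ) : Matrix (Fin n ⊕ Fin m) (Fin n ⊕ Fin m) ℝ :=
  Matrix.fromBlocks (S.mass t q ρ) (S.constrQ t q ρ).transpose (S.constrQ t q ρ) 0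

/-- The curve `(q, v)` satisfies at time `t` the equations of motion with parameter `ρ`:
`q' = v`, `M v' = F + Φ_qᵀ λ` for some multipliers `λ`, and `Φ = 0`. -/
def SolvesAt (S : MultibodySystem n m p) (ρ : Fin p → ℝ) (q v : ℝ → (Fin n → ℝ)) (t : ℝ) : Prop :=
  HasDerivAt q (v t) t ∧
  (∃ (a : Fin n → ℝ) (lam : Fin m → ℝ), HasDerivAt v a t ∧
    (S.mass t (q t) ρ).mulVec a =
      S.force t (q t) (v t) ρ + (S.constrQ t (q t) ρ).transpose.mulVec lam) ∧
  S.constr t (q t) ρ = 0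

/-- The block `Φ_{q_dep}`, for the partition `e` of the coordinates: `e (inl i)` is the position
of the `i`-th dependent coordinate and `e (inr i)` that of the `i`-th independent one. -/
noncomputable def constrDep (S : MultibodySystem n m p) (e : Fin m ⊕ Fin f ≃ Fin n) (t : ℝ)
    (q : Fin n → ℝ) (ρ : Fin p → ℝ) : Matrix (Fin m) (Fin m) ℝ :=
  (S.constrQ t q ρ).submatrix id (fun i => e (Sum.inl i))

/-- The block `Φ_{q_dof}`. -/
noncomputable def constrDof (S : MultibodySystem n m p) (e : Fin m ⊕ Fin f ≃ Fin n) (t : ℝ)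
    (q : Fin n → ℝ) (ρ : Fin p → ℝ) : Matrix (Fin m) (Fin f) ℝ :=
  (S.constrQ t q ρ).submatrix id (fun i => e (Sum.inr i))

/-- The matrix `R = -Φ_{q_dep}⁻¹ Φ_{q_dof}`. -/
noncomputable def matrixR (S : MultibodySystem n m p) (e : Fin m ⊕ Fin f ≃ Fin n) (t : ℝ)
    (q : Fin n → ℝ) (ρ : Fin p → ℝ) : Matrix (Fin m) (Fin f) ℝ :=
  -((S.constrDep e t q ρ)⁻¹ * S.constrDof e t q ρ)

end MultibodySystem

/-- Independent (dof) components of a vector of coordinates. -/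
def dofVec {n m f : ℕ} (e : Fin m ⊕ Fin f ≃ Fin n) (x : Fin n → ℝ) : Fin f → ℝ :=
  fun i => x (e (Sum.inr i))

/-- Independent (dof) rows of a sensitivity matrix. -/
def dofRows {n m f p : ℕ} (e : Fin m ⊕ Fin f ≃ Fin n) (A : Matrix (Fin n) (Fin p) ℝ) :
    Matrix (Fin f) (Fin p) ℝ :=
  A.submatrix (fun i => e (Sum.inr i)) id

/-- Dependent rows of a sensitivity matrix. -/
def depRows {n m f p : ℕ} (e : Fin m ⊕ Fin f ≃ Fin n) (A : Matrix (Fin n) (Fin p) ℝ) :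
    Matrix (Fin m) (Fin p) ℝ :=
  A.submatrix (fun i => e (Sum.inl i)) id

/-- The position sensitivity `Q(t, ρ) = dq/dρ (t, ρ)`. -/
noncomputable def positionSensitivity {n p : ℕ} (q : ℝ → (Fin p → ℝ) → (Fin n → ℝ)) (t : ℝ)
    (ρ : Fin p → ℝ) : Matrix (Fin n) (Fin p) ℝ :=
  jacobianMatrix (fun x => q t x) ρ

/-- The row vector `dτ/dρ` of a scalar function of the parameters. -/
noncomputable def timeSensitivity {p : ℕ} (τ : (Fin p → ℝ) → ℝ) (ρ : Fin p → ℝ) : Fin p → ℝ :=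
  fun j => fderiv ℝ τ ρ (Pi.single j 1)

/-- For the parameter `ρ`, the curve `(q, v)` on `[t₀, t_F]` is a trajectory of the hybrid
constrained system with initial state `(qInit, vInit)`, event function `r`, jump function `h`,
exactly one event, at time `τ`, and one-sided velocities `vMinus`, `vPlus` at the event.
The value of `v` at `τ` itself is irrelevant. -/
structure IsHybridTrajectory {n mMinus mPlus fMinus fPlus p : ℕ}
    (SMinus : MultibodySystem n mMinus p) (SPlus : MultibodySystem n mPlus p)
    (eMinus : Fin mMinus ⊕ Fin fMinus ≃ Fin n) (ePlus : Fin mPlus ⊕ Fin fPlus ≃ Fin n)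
    (r : (Fin n → ℝ) → ℝ)
    (h : ℝ → (Fin n → ℝ) → (Fin fMinus → ℝ) → (Fin p → ℝ) → (Fin fPlus → ℝ))
    (t₀ tF : ℝ) (qInit vInit : Fin n → ℝ) (ρ : Fin p → ℝ)
    (q v : ℝ → (Fin n → ℝ)) (τ : ℝ) (vMinus vPlus : Fin n → ℝ) : Prop where
  /-- initial conditions -/
  init_q : q t₀ = qInit
  init_v : v t₀ = vInit
  /-- the event takes place strictly inside the time window -/
  event_mem : τ ∈ Set.Ioo t₀ tF
  /-- positions are continuous, also across the event; velocities are continuous elsewhere -/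
  continuous_q : ContinuousOn q (Set.Icc t₀ tF)
  continuous_v_before : ContinuousOn v (Set.Ico t₀ τ)
  continuous_v_after : ContinuousOn v (Set.Ioc τ tF)
  /-- equations of motion before and after the event -/
  solves_before : ∀ t ∈ Set.Ioo t₀ τ, SMinus.SolvesAt ρ q v t
  solves_after : ∀ t ∈ Set.Ioo τ tF, SPlus.SolvesAt ρ q v t
  /-- the event is triggered at the first zero of the event function -/
  event : r (q τ) = 0
  no_event_before : ∀ t ∈ Set.Ico t₀ τ, r (q t) ≠ 0
  /-- the position at the event satisfies both constraints -/
  constr_before : SMinus.constr τ (q τ) ρ = 0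
  constr_after : SPlus.constr τ (q τ) ρ = 0
  /-- one-sided velocities at the event -/
  tendsto_vMinus : Tendsto v (𝓝[<] τ) (𝓝 vMinus)
  tendsto_vPlus : Tendsto v (𝓝[>] τ) (𝓝 vPlus)
  /-- jump of the independent velocities -/
  jump : dofVec ePlus vPlus = h τ (q τ) (dofVec eMinus vMinus) ρ
  /-- velocity constraint after the event, which determines the dependent velocities -/
  velocity_constr : (SPlus.constrQ τ (q τ) ρ).mulVec vPlus = -SPlus.constrT τ (q τ) ρ

/-! On either side of the event the trajectories are orbits `Φ (t - σ ρ) (ξ ρ)` of a flow, which can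
be differentiated in `ρ` as soon as the starting time `σ` and the starting state `ξ` can. The
formulas come from differentiating the event position `q (τ ρ) ρ` in two ways. As the end of the
motion before the event it has derivative `Q⁻ + v⁻ τ'`; as the start of the motion after the event
it has derivative `Q⁺ + v⁺ τ'`. Hence `Q⁺ = Q⁻ - (v⁺ - v⁻) τ'` in all components, in particular the
independent ones. Differentiating `Φ⁺ = 0` at the event and replacing `Φ⁺_t` by `-Φ⁺_q v⁺` gives
`Φ⁺_q Q⁺ = -Φ⁺_ρ`, which is solved for the dependent rows.

Three points need work. First, two differentiations of the constraint turn the equations of motion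
into a smooth autonomous field on the states `(t, q, v, ρ)`
(`MultibodySystem.SolvesAt.hasDerivAt_extendedState`). Cut off near the nominal trajectory
(`exists_isGlobalFlow_eqOn`), it has a global flow, differentiable in the initial point by the
variational equation and Grönwall (`IsGlobalFlow.exists_hasFDerivAt_short`). Neighbouring
trajectories are not assumed close to the nominal one; `IsGlobalFlow.eqOn_of_forall_mem` shows that
they follow this flow.

Second, transversality and compactness make the first zero of the event function continuous in `ρ`
(`tendsto_firstZero`), and implicit differentiation then makes it differentiable
(`hasFDerivAt_of_implicit`).

Third, jump function and velocity constraint determine `v⁺` as a smooth function of the state before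
the event (`eq_resetVelocity`), so the motion after the event starts from differentiable data. -/

section GlobalFlow

/-! ### Global flows of bounded Lipschitz fields -/

open Set Metric
open scoped NNReal

variable {E : Type*} [NormedAddCommGroup E] [NormedSpace ℝ E]

/-- `Φ` is the global flow of the vector field `W`: the curve `t ↦ Φ t x` is the integral curve
of `W` through `x`. -/
structure IsGlobalFlow (W : E → E) (Φ : ℝ → E → E) : Prop where
  zero : ∀ x, Φ 0 x = x
  hasDerivAt : ∀ x t, HasDerivAt (fun s => Φ s x) (W (Φ t x)) t

/-- A bounded Lipschitz vector field has integral curves on every bounded symmetric interval. -/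
theorem exists_integralCurve_Icc [CompleteSpace E] {W : E → E} {K L : ℝ≥0}
    (hK : LipschitzWith K W) (hL : ∀ x, ‖W x‖ ≤ L) (x : E) (T : ℝ≥0) :
    ∃ γ : ℝ → E, γ 0 = x ∧ ∀ t ∈ Ioo (-T : ℝ) T, HasDerivAt γ (W (γ t)) t := by
  have h0 : (0 : ℝ) ∈ Icc (-T : ℝ) T := ⟨by simp, T.2⟩
  -- The radius `L * T` is what a curve of speed at most `L` can cover in time `T`, so `T` need not
  -- be small.
  have hP : IsPicardLindelof (fun _ => W) (⟨0, h0⟩ : Icc (-T : ℝ) T) x (L * T) 0 L K :=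
    IsPicardLindelof.of_time_independent (fun y _ => hL y) hK.lipschitzOnWith (by simp)
  obtain ⟨γ, hγ0, hγ⟩ := hP.exists_eq_forall_mem_Icc_hasDerivWithinAt₀
  exact ⟨γ, hγ0, fun t ht => (hγ t ⟨ht.1.le, ht.2.le⟩).hasDerivAt (Icc_mem_nhds ht.1 ht.2)⟩

/-- A bounded Lipschitz vector field has global integral curves. -/
theorem exists_integralCurve [CompleteSpace E] {W : E → E} {K L : ℝ≥0}
    (hK : LipschitzWith K W) (hL : ∀ x, ‖W x‖ ≤ L) (x : E) :
    ∃ γ : ℝ → E, γ 0 = x ∧ ∀ t, HasDerivAt γ (W (γ t)) t := by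
  choose α hα0 hα using exists_integralCurve_Icc hK hL x
  have agree : ∀ S T : ℝ≥0, S ≤ T → ∀ t ∈ Ioo (-S : ℝ) S, α S t = α T t := by
    intro S T hST t ht
    have hS : (0 : ℝ) < S := by have := ht.1; have := ht.2; linarith
    have hST' : (S : ℝ) ≤ T := hST
    exact ODE_solution_unique_of_mem_Ioo (v := fun _ => W) (s := fun _ => univ) (t₀ := 0)
      (fun _ _ => hK.lipschitzOnWith) ⟨by linarith, hS⟩
      (fun s hs => ⟨hα S s hs, trivial⟩)
      (fun s hs => ⟨hα T s ⟨by linarith [hs.1], by linarith [hs.2]⟩, trivial⟩)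
      (by rw [hα0, hα0]) ht
  -- The interval of definition depends on `t`; for all `s` within distance 1 of `t` the single
  -- solution with bound `‖t‖₊ + 2` can be used instead, which yields the derivative.
  refine ⟨fun t => α (‖t‖₊ + 1) t, hα0 _, fun t => ?_⟩
  have key : ∀ s ∈ ball t 1, α (‖s‖₊ + 1) s = α (‖t‖₊ + 2) s := by
    intro s hs
    have hs' : |s - t| < 1 := by simpa [Real.dist_eq] using hs
    have h1 : |s| ≤ |t| + 1 := by
      have := abs_sub_abs_le_abs_sub s t
      linarith
    refine agree _ _ ?_ s ?_
    · rw [← NNReal.coe_le_coe]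
      push_cast
      simp only [Real.norm_eq_abs]
      linarith
    · push_cast
      simp only [Real.norm_eq_abs]
      exact ⟨by linarith [neg_abs_le s], by linarith [le_abs_self s]⟩
  have ht : t ∈ Ioo (-((‖t‖₊ + 2 : ℝ≥0) : ℝ)) ((‖t‖₊ + 2 : ℝ≥0) : ℝ) := by
    push_cast
    simp only [Real.norm_eq_abs]
    exact ⟨by linarith [neg_abs_le t], by linarith [le_abs_self t]⟩
  have hd := hα (‖t‖₊ + 2) t ht
  rw [← key t (mem_ball_self one_pos)] at hd
  refine hd.congr_of_eventuallyEq ?_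
  filter_upwards [ball_mem_nhds t one_pos] with s hs using key s hs

/-- A bounded Lipschitz vector field has a global flow. -/
theorem exists_isGlobalFlow [CompleteSpace E] {W : E → E} {K L : ℝ≥0}
    (hK : LipschitzWith K W) (hL : ∀ x, ‖W x‖ ≤ L) : ∃ Φ : ℝ → E → E, IsGlobalFlow W Φ := by
  choose γ h0 h using exists_integralCurve hK hL
  exact ⟨fun t x => γ x t, h0, h⟩

namespace IsGlobalFlow

variable {W : E → E} {Φ : ℝ → E → E} {K : ℝ≥0}

theorem continuous_time (hΦ : IsGlobalFlow W Φ) (x : E) : Continuous fun t => Φ t x :=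
  continuous_iff_continuousAt.2 fun t => (hΦ.hasDerivAt x t).continuousAt

theorem neg (hΦ : IsGlobalFlow W Φ) : IsGlobalFlow (fun x => -W x) (fun t => Φ (-t)) where
  zero x := by simpa using hΦ.zero x
  hasDerivAt x t := by
    simpa [Function.comp_def] using (hΦ.hasDerivAt x (-t)).scomp t (hasDerivAt_neg t)

theorem dist_le_of_nonneg (hΦ : IsGlobalFlow W Φ) (hK : LipschitzWith K W) (x y : E) {t : ℝ}
    (ht : 0 ≤ t) : dist (Φ t x) (Φ t y) ≤ dist x y * Real.exp (K * t) := by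
  have := dist_le_of_trajectories_ODE (v := fun _ => W) (K := K) (a := 0) (b := t)
    (fun _ => hK) (hΦ.continuous_time x).continuousOn
    (fun s _ => (hΦ.hasDerivAt x s).hasDerivWithinAt) (hΦ.continuous_time y).continuousOn
    (fun s _ => (hΦ.hasDerivAt y s).hasDerivWithinAt) (δ := dist x y)
    (by simp [hΦ.zero]) t ⟨ht, le_rfl⟩
  simpa using this

theorem dist_le (hΦ : IsGlobalFlow W Φ) (hK : LipschitzWith K W) (x y : E) (t : ℝ) :
    dist (Φ t x) (Φ t y) ≤ dist x y * Real.exp (K * |t|) := by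
  rcases le_total 0 t with ht | ht
  · rw [abs_of_nonneg ht]
    exact hΦ.dist_le_of_nonneg hK x y ht
  · rw [abs_of_nonpos ht]
    simpa using hΦ.neg.dist_le_of_nonneg hK.neg x y (neg_nonneg.2 ht)

theorem continuous_uncurry (hΦ : IsGlobalFlow W Φ) (hK : LipschitzWith K W) :
    Continuous fun z : ℝ × E => Φ z.1 z.2 := by
  refine continuous_iff_continuousAt.2 fun ⟨t, x⟩ => ?_
  rw [ContinuousAt, tendsto_iff_dist_tendsto_zero]
  have h1 : Tendsto (fun z : ℝ × E => dist z.2 x * Real.exp (K * |z.1|) + dist (Φ z.1 x) (Φ t x))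
      (𝓝 (t, x)) (𝓝 (dist x x * Real.exp (K * |t|) + dist (Φ t x) (Φ t x))) := by
    have hc : Continuous fun z : ℝ × E =>
        dist z.2 x * Real.exp (K * |z.1|) + dist (Φ z.1 x) (Φ t x) := by
      have := (hΦ.continuous_time x).comp (continuous_fst : Continuous fun z : ℝ × E => z.1)
      have h2 : Continuous fun z : ℝ × E => dist (Φ z.1 x) (Φ t x) :=
        this.dist continuous_const
      fun_prop
    exact hc.tendsto (t, x)
  rw [dist_self, dist_self, zero_mul, zero_add] at h1
  refine squeeze_zero (fun _ => dist_nonneg) (fun z => ?_) h1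
  exact (dist_triangle _ (Φ z.1 x) _).trans (by gcongr; exact hΦ.dist_le hK _ _ _)

theorem add (hΦ : IsGlobalFlow W Φ) (hK : LipschitzWith K W) (t s : ℝ) (x : E) :
    Φ (t + s) x = Φ t (Φ s x) := by
  have := ODE_solution_unique_univ (v := fun _ => W) (s := fun _ => univ) (K := K) (t₀ := 0)
    (f := fun t => Φ (t + s) x) (g := fun t => Φ t (Φ s x)) (fun _ => hK.lipschitzOnWith)
    (fun t => ⟨(hΦ.hasDerivAt x (t + s)).comp_add_const t s, trivial⟩)
    (fun t => ⟨hΦ.hasDerivAt (Φ s x) t, trivial⟩) (by simp [hΦ.zero])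
  exact congrFun this t

/-- Orbits that stay in an open set over a compact time set keep doing so after a small
perturbation of the initial point. -/
theorem eventually_forall_mem (hΦ : IsGlobalFlow W Φ) (hK : LipschitzWith K W) {I : Set ℝ}
    (hI : IsCompact I) {N : Set E} (hN : IsOpen N) {x : E} (h : ∀ t ∈ I, Φ t x ∈ N) :
    ∀ᶠ y in 𝓝 x, ∀ t ∈ I, Φ t y ∈ N := by
  refine hI.eventually_forall_of_forall_eventually fun t ht => ?_
  have hc : Continuous fun z : E × ℝ => Φ z.2 z.1 :=
    (hΦ.continuous_uncurry hK).comp (continuous_snd.prodMk continuous_fst)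
  exact hc.continuousAt.eventually (hN.mem_nhds (h t ht))

end IsGlobalFlow

/-! ### Differentiability of the flow in time and initial point -/

theorem gronwallBound_zero_eq_mul (K ε x : ℝ) :
    gronwallBound 0 K ε x = ε * gronwallBound 0 K 1 x := by
  by_cases hK : K = 0
  · simp [gronwallBound, hK]
  · simp [gronwallBound, hK]
    ring

/-- The linear variational equation along a curve is solvable over a short time. -/
theorem exists_variational_solution [CompleteSpace E] {A : ℝ → E →L[ℝ] E} (hA : Continuous A)
    {K : ℝ≥0} (hAK : ∀ t, ‖A t‖ ≤ K) {T : ℝ} (hT : 0 ≤ T) (hKT : 2 * K * T ≤ 1) :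
    ∃ J : ℝ → E →L[ℝ] E, J 0 = ContinuousLinearMap.id ℝ E ∧
      ∀ t ∈ Icc 0 T, HasDerivWithinAt J ((A t).comp (J t)) (Icc 0 T) t := by
  -- In the unit ball about the identity `‖Z‖ ≤ 2`, so the speed is at most `2 * K`; the bound on
  -- `T` keeps the solution in that ball.
  have hP : IsPicardLindelof (fun t (Z : E →L[ℝ] E) => (A t).comp Z)
      (⟨0, le_rfl, hT⟩ : Icc (0 : ℝ) T) (ContinuousLinearMap.id ℝ E) 1 0 (2 * K) K := by
    refine ⟨fun t _ => LipschitzWith.lipschitzOnWith ?_, fun Z _ => ?_, fun t _ Z hZ => ?_, ?_⟩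
    · refine LipschitzWith.of_dist_le_mul fun Z Z' => ?_
      rw [dist_eq_norm, dist_eq_norm, ← ContinuousLinearMap.comp_sub]
      exact (ContinuousLinearMap.opNorm_comp_le _ _).trans (by gcongr; exact hAK t)
    · exact (hA.clm_comp continuous_const).continuousOn
    · have h1 : ‖Z‖ ≤ 2 := by
        have h2 : ‖Z - ContinuousLinearMap.id ℝ E‖ ≤ 1 := by simpa [dist_eq_norm] using hZ
        have h3 : ‖ContinuousLinearMap.id ℝ E‖ ≤ 1 := ContinuousLinearMap.norm_id_le
        have := norm_le_norm_sub_add Z (ContinuousLinearMap.id ℝ E)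
        linarith
      calc ‖(A t).comp Z‖ ≤ ‖A t‖ * ‖Z‖ := ContinuousLinearMap.opNorm_comp_le _ _
        _ ≤ K * 2 := by gcongr; exact hAK t
        _ = ((2 * K : ℝ≥0) : ℝ) := by push_cast; ring
    · simpa [hT] using hKT
  exact hP.exists_eq_forall_mem_Icc_hasDerivWithinAt₀

namespace IsGlobalFlow

variable {W : E → E} {Φ : ℝ → E → E} {K : ℝ≥0}

/-- The first order Taylor remainder of the vector field is small uniformly along an orbit. -/
theorem eventually_taylor_remainder_le (hΦ : IsGlobalFlow W Φ) (hK : LipschitzWith K W)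
    (hW : ContDiff ℝ 1 W) {I : Set ℝ} (hI : IsCompact I) (x : E) {ε : ℝ} (hε : 0 < ε) :
    ∀ᶠ y in 𝓝 x, ∀ t ∈ I, ‖W (Φ t y) - W (Φ t x) - fderiv ℝ W (Φ t x) (Φ t y - Φ t x)‖ ≤
      ε * ‖Φ t y - Φ t x‖ := by
  refine hI.eventually_forall_of_forall_eventually fun t _ => ?_
  have hc : Continuous fun z : E × ℝ => (Φ z.2 z.1, Φ z.2 x) := by
    have h1 : Continuous fun z : E × ℝ => Φ z.2 z.1 :=
      (hΦ.continuous_uncurry hK).comp (continuous_snd.prodMk continuous_fst)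
    exact h1.prodMk ((hΦ.continuous_time x).comp continuous_snd)
  -- Both points of the Taylor estimate move with the time variable, hence strict differentiability
  -- at `Φ t x`; continuity of `fderiv ℝ W` then moves the derivative to the varying base point.
  have hstrict := (hW.contDiffAt (x := Φ t x)).hasStrictFDerivAt (by norm_num)
  have e1 := hstrict.isLittleO.def (half_pos hε)
  have e2 : ∀ᶠ z in 𝓝 (Φ t x), ‖fderiv ℝ W z - fderiv ℝ W (Φ t x)‖ < ε / 2 := by
    have hcont : Continuous (fderiv ℝ W) := hW.continuous_fderiv (by norm_num)
    have := (hcont.tendsto (Φ t x)).eventually (ball_mem_nhds _ (half_pos hε))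
    simpa [dist_eq_norm] using this
  have hct : Tendsto (fun z : E × ℝ => (Φ z.2 z.1, Φ z.2 x)) (𝓝 (x, t))
      (𝓝 (Φ t x, Φ t x)) := hc.tendsto (x, t)
  filter_upwards [hct.eventually e1, (hct.snd_nhds).eventually e2] with z h1 h2
  have h3 : W (Φ z.2 z.1) - W (Φ z.2 x) - fderiv ℝ W (Φ z.2 x) (Φ z.2 z.1 - Φ z.2 x) =
      (W (Φ z.2 z.1) - W (Φ z.2 x) - fderiv ℝ W (Φ t x) (Φ z.2 z.1 - Φ z.2 x)) -
        (fderiv ℝ W (Φ z.2 x) - fderiv ℝ W (Φ t x)) (Φ z.2 z.1 - Φ z.2 x) := by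
    simp
  rw [h3]
  refine (norm_sub_le _ _).trans ?_
  have h4 := (ContinuousLinearMap.le_opNorm (fderiv ℝ W (Φ z.2 x) - fderiv ℝ W (Φ t x))
    (Φ z.2 z.1 - Φ z.2 x)).trans (mul_le_mul_of_nonneg_right h2.le (norm_nonneg _))
  linarith

/-- Differentiability of the flow in the initial point, over a short time. -/
theorem exists_hasFDerivAt_short [CompleteSpace E] (hΦ : IsGlobalFlow W Φ)
    (hK : LipschitzWith K W) (hW : ContDiff ℝ 1 W) {T : ℝ} (hT : 0 ≤ T) (hKT : 2 * K * T ≤ 1)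
    (x : E) : ∃ J : ℝ → E →L[ℝ] E, ContinuousOn J (Icc 0 T) ∧
      ∀ t ∈ Icc 0 T, HasFDerivAt (Φ t) (J t) x := by
  have hAc : Continuous fun t => fderiv ℝ W (Φ t x) :=
    (hW.continuous_fderiv (by norm_num)).comp (hΦ.continuous_time x)
  have hAK : ∀ t, ‖fderiv ℝ W (Φ t x)‖ ≤ K := fun t => norm_fderiv_le_of_lipschitz ℝ hK
  obtain ⟨J, hJ0, hJ⟩ := exists_variational_solution hAc hAK hT hKT
  have hJc : ContinuousOn J (Icc 0 T) := fun t ht => (hJ t ht).continuousWithinAt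
  refine ⟨J, hJc, fun t ht => ?_⟩
  refine HasFDerivAt.of_isLittleO (Asymptotics.isLittleO_iff.2 fun c hc => ?_)
  set M := Real.exp (K * T)
  set G := gronwallBound 0 K 1 t
  have hG : 0 ≤ G := by
    have := gronwallBound_mono (δ := 0) (ε := 1) (K := K) le_rfl zero_le_one K.2 ht.1
    rwa [gronwallBound_x0] at this
  have hM : 0 < M := Real.exp_pos _
  -- Grönwall will bound the error by this number times `M * G * ‖y - x‖`; the `+ 1` only keeps the
  -- denominator positive.
  have hε : 0 < c / (M * G + 1) := by positivity
  filter_upwards [hΦ.eventually_taylor_remainder_le hK hW (isCompact_Icc (a := (0 : ℝ)) (b := T))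
    x hε] with y hy
  have hJy : ∀ s ∈ Icc 0 T, HasDerivWithinAt (fun s => J s (y - x))
      (fderiv ℝ W (Φ s x) (J s (y - x))) (Icc 0 T) s := fun s hs => by
    simpa using (hJ s hs).clm_apply (hasDerivWithinAt_const s (Icc 0 T) (y - x))
  -- The error of the linear approximation obeys the variational equation up to the Taylor remainder
  -- of `W` and starts at zero.
  have hu : ∀ s ∈ Icc 0 T, HasDerivWithinAt (fun s => Φ s y - Φ s x - J s (y - x))
      (W (Φ s y) - W (Φ s x) - fderiv ℝ W (Φ s x) (J s (y - x))) (Icc 0 T) s := fun s hs =>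
    ((hΦ.hasDerivAt y s).hasDerivWithinAt.sub (hΦ.hasDerivAt x s).hasDerivWithinAt).sub (hJy s hs)
  have hbound := norm_le_gronwallBound_of_norm_deriv_right_le
    (f := fun s => Φ s y - Φ s x - J s (y - x)) (δ := 0) (K := K)
    (ε := c / (M * G + 1) * (M * ‖y - x‖)) (a := 0) (b := T)
    (fun s hs => (hu s hs).continuousWithinAt)
    (fun s hs => (hu s ⟨hs.1, hs.2.le⟩).mono_of_mem_nhdsWithin (Icc_mem_nhdsGE_of_mem hs))
    (by simp [hΦ.zero, hJ0]) (fun s hs => ?_) t ht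
  · simp only [sub_zero] at hbound
    rw [gronwallBound_zero_eq_mul] at hbound
    refine hbound.trans ?_
    have : c / (M * G + 1) * (M * G) ≤ c := by
      rw [div_mul_eq_mul_div, div_le_iff₀ (by positivity)]
      nlinarith
    calc c / (M * G + 1) * (M * ‖y - x‖) * G = c / (M * G + 1) * (M * G) * ‖y - x‖ := by ring
      _ ≤ c * ‖y - x‖ := by gcongr
  · have h1 : W (Φ s y) - W (Φ s x) - fderiv ℝ W (Φ s x) (J s (y - x)) =
        fderiv ℝ W (Φ s x) (Φ s y - Φ s x - J s (y - x)) +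
          (W (Φ s y) - W (Φ s x) - fderiv ℝ W (Φ s x) (Φ s y - Φ s x)) := by
      simp only [map_sub]
      abel
    rw [h1]
    have h2 : ‖Φ s y - Φ s x‖ ≤ M * ‖y - x‖ := by
      have := hΦ.dist_le_of_nonneg hK y x hs.1
      rw [dist_eq_norm, dist_eq_norm, mul_comm] at this
      refine this.trans ?_
      gcongr
      exact Real.exp_le_exp.2 (by gcongr; exact hs.2.le)
    refine (norm_add_le _ _).trans (add_le_add ?_ ?_)
    · exact (ContinuousLinearMap.le_opNorm _ _).trans (by gcongr; exact hAK s)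
    · exact (hy s ⟨hs.1, hs.2.le⟩).trans (by gcongr)

/-- The flow of a Lipschitz `C¹` vector field is differentiable in the initial point, with a
derivative that is continuous in time. -/
theorem differentiableAt_and_continuousOn_fderiv [CompleteSpace E] (hΦ : IsGlobalFlow W Φ)
    (hK : LipschitzWith K W) (hW : ContDiff ℝ 1 W) (N : ℕ) :
    ∀ x, (∀ t ∈ Icc 0 (N * (2 * K + 1 : ℝ)⁻¹), DifferentiableAt ℝ (Φ t) x) ∧
      ContinuousOn (fun t => fderiv ℝ (Φ t) x) (Icc 0 (N * (2 * K + 1 : ℝ)⁻¹)) := by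
  set T : ℝ := (2 * K + 1)⁻¹ with hTdef
  have hT : 0 ≤ T := by positivity
  have hKT : 2 * K * T ≤ 1 := by
    rw [hTdef, ← div_eq_mul_inv, div_le_one (by positivity)]
    linarith
  have short : ∀ x, (∀ t ∈ Icc 0 T, DifferentiableAt ℝ (Φ t) x) ∧
      ContinuousOn (fun t => fderiv ℝ (Φ t) x) (Icc 0 T) := fun x => by
    obtain ⟨J, hJc, hJ⟩ := hΦ.exists_hasFDerivAt_short hK hW hT hKT x
    exact ⟨fun t ht => (hJ t ht).differentiableAt, hJc.congr fun t ht => (hJ t ht).fderiv⟩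
  induction N with
  | zero =>
    intro x
    have : Icc (0 : ℝ) ((0 : ℕ) * T) ⊆ Icc 0 T := by simpa using hT
    exact ⟨fun t ht => (short x).1 t (this ht), (short x).2.mono this⟩
  | succ N ih =>
    intro x
    have hsplit : Icc (0 : ℝ) ((N + 1 : ℕ) * T) = Icc 0 (N * T) ∪ Icc (N * T) ((N + 1 : ℕ) * T) :=
      (Icc_union_Icc_eq_Icc (by positivity) (by gcongr; simp)).symm
    have hend : (N * T : ℝ) ∈ Icc (0 : ℝ) (N * T) := ⟨by positivity, le_rfl⟩
    have hmem : ∀ t ∈ Icc (N * T : ℝ) ((N + 1 : ℕ) * T), t - N * T ∈ Icc 0 T := fun t ht => by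
      have := ht.2
      push_cast at this
      exact ⟨by linarith [ht.1], by linarith⟩
    -- By the group law, the flow on the next interval is a short flow after the flow to time `N *
    -- T`; the chain rule applies.
    have hcomp : ∀ t ∈ Icc (N * T : ℝ) ((N + 1 : ℕ) * T), HasFDerivAt (Φ t)
        ((fderiv ℝ (Φ (t - N * T)) (Φ (N * T) x)).comp (fderiv ℝ (Φ (N * T)) x)) x := fun t ht => by
      have h1 := ((short (Φ (N * T) x)).1 _ (hmem t ht)).hasFDerivAt.comp x
        ((ih x).1 _ hend).hasFDerivAt
      refine h1.congr_of_eventuallyEq (Eventually.of_forall fun y => ?_)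
      simp only [Function.comp_apply]
      rw [← hΦ.add hK, sub_add_cancel]
    rw [hsplit]
    refine ⟨fun t ht => ht.elim ((ih x).1 t) fun ht => (hcomp t ht).differentiableAt, ?_⟩
    refine (ih x).2.union_of_isClosed ?_ isClosed_Icc isClosed_Icc
    refine ContinuousOn.congr ?_ fun t ht => (hcomp t ht).fderiv
    refine ContinuousOn.clm_comp ?_ continuousOn_const
    exact (short (Φ (N * T) x)).2.comp (by fun_prop) hmem

theorem exists_nat_mul_inv_gt (K : ℝ≥0) (t : ℝ) : ∃ N : ℕ, t < N * (2 * K + 1 : ℝ)⁻¹ := by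
  obtain ⟨N, hN⟩ := exists_nat_gt (t * (2 * K + 1))
  exact ⟨N, by rwa [← div_eq_mul_inv, lt_div_iff₀ (by positivity)]⟩

theorem differentiableAt [CompleteSpace E] (hΦ : IsGlobalFlow W Φ) (hK : LipschitzWith K W)
    (hW : ContDiff ℝ 1 W) (x : E) {t : ℝ} (ht : 0 ≤ t) : DifferentiableAt ℝ (Φ t) x := by
  obtain ⟨N, hN⟩ := exists_nat_mul_inv_gt K t
  exact (hΦ.differentiableAt_and_continuousOn_fderiv hK hW N x).1 t ⟨ht, hN.le⟩

theorem continuousOn_fderiv [CompleteSpace E] (hΦ : IsGlobalFlow W Φ) (hK : LipschitzWith K W)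
    (hW : ContDiff ℝ 1 W) (x : E) : ContinuousOn (fun t => fderiv ℝ (Φ t) x) (Ici 0) := by
  intro t ht
  obtain ⟨N, hN⟩ := exists_nat_mul_inv_gt K t
  refine ((hΦ.differentiableAt_and_continuousOn_fderiv hK hW N x).2 t
    ⟨ht, hN.le⟩).mono_of_mem_nhdsWithin ?_
  rw [← Ici_inter_Iic]
  exact inter_mem self_mem_nhdsWithin (mem_nhdsWithin_of_mem_nhds (Iic_mem_nhds hN))

/-- Joint differentiability of the flow in time and initial point. -/
theorem hasFDerivAt_uncurry [CompleteSpace E] (hΦ : IsGlobalFlow W Φ) (hK : LipschitzWith K W)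
    (hW : ContDiff ℝ 1 W) (x : E) {t : ℝ} (ht : 0 ≤ t) :
    HasFDerivAt (fun z : ℝ × E => Φ z.1 z.2)
      ((ContinuousLinearMap.toSpanSingleton ℝ (W (Φ t x))).coprod (fderiv ℝ (Φ t) x)) (t, x) := by
  -- The expansion in time is uniform in the initial point: by joint continuity the velocity stays
  -- near `W (Φ t x)`, and the mean value inequality applies.
  have h1 : (fun z : ℝ × E => Φ z.1 z.2 - Φ t z.2 -
      ContinuousLinearMap.toSpanSingleton ℝ (W (Φ t x)) (z.1 - t)) =o[𝓝 (t, x)]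
        fun z : ℝ × E => z.1 - t := by
    refine Asymptotics.isLittleO_iff.2 fun c hc => ?_
    have hW' : Tendsto (fun z : ℝ × E => W (Φ z.1 z.2)) (𝓝 (t, x)) (𝓝 (W (Φ t x))) :=
      (hK.continuous.comp (hΦ.continuous_uncurry hK)).tendsto (t, x)
    obtain ⟨δ, hδ, hball⟩ := Metric.eventually_nhds_iff_ball.1
      (hW'.eventually (closedBall_mem_nhds _ hc))
    filter_upwards [ball_mem_nhds (t, x) hδ] with z hz
    have hz' : dist z.1 t < δ ∧ dist z.2 x < δ := by
      simpa [Prod.dist_eq] using hz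
    have := (convex_uIcc t z.1).norm_image_sub_le_of_norm_hasDerivWithin_le
      (f := fun s => Φ s z.2 - s • W (Φ t x)) (f' := fun s => W (Φ s z.2) - W (Φ t x)) (C := c)
      (fun s _ => by
        have := (hΦ.hasDerivAt z.2 s).sub ((hasDerivAt_id s).smul_const (W (Φ t x)))
        rw [one_smul] at this
        exact this.hasDerivWithinAt)
      (fun s hs => by
        have hs' : dist s t ≤ dist z.1 t := by
          rw [Real.dist_eq, Real.dist_eq]
          exact abs_sub_left_of_mem_uIcc hs
        have := hball (s, z.2) (by
          rw [mem_ball, Prod.dist_eq]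
          exact max_lt (hs'.trans_lt hz'.1) hz'.2)
        simpa [dist_eq_norm] using this) left_mem_uIcc right_mem_uIcc
    refine (le_of_eq ?_).trans this
    congr 1
    simp only [ContinuousLinearMap.toSpanSingleton_apply, sub_smul]
    abel
  have h2 : HasFDerivAt (fun z : ℝ × E => Φ t z.2)
      ((fderiv ℝ (Φ t) x).comp (ContinuousLinearMap.snd ℝ ℝ E)) (t, x) :=
    HasFDerivAt.comp (t, x) (hΦ.differentiableAt hK hW x ht).hasFDerivAt hasFDerivAt_snd
  refine HasFDerivAt.of_isLittleO ?_
  have h3 : (fun z : ℝ × E => z.1 - t) =O[𝓝 (t, x)] fun z => z - (t, x) :=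
    Asymptotics.IsBigO.of_bound 1 (Eventually.of_forall fun z => by
      simpa using norm_fst_le (z - (t, x)))
  refine ((h1.trans_isBigO h3).add h2.isLittleO).congr_left fun z => ?_
  simp only [ContinuousLinearMap.coprod_apply, ContinuousLinearMap.comp_apply, Prod.fst_sub,
    Prod.snd_sub, ContinuousLinearMap.coe_snd']
  abel

/-! ### Identifying curves with orbits -/

/-- A continuous curve that follows the vector field in the interior of a time interval agrees
with the flow. -/
theorem eqOn_of_hasDerivAt (hΦ : IsGlobalFlow W Φ) (hK : LipschitzWith K W) {γ : ℝ → E}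
    {a b : ℝ} (hγ : ContinuousOn γ (Icc a b)) (hγ' : ∀ t ∈ Ioo a b, HasDerivAt γ (W (γ t)) t) :
    ∀ t ∈ Icc a b, γ t = Φ (t - a) (γ a) := by
  rcases lt_or_ge a b with hab | hab
  swap
  · intro t ht
    obtain rfl : t = a := le_antisymm (ht.2.trans hab) ht.1
    rw [sub_self, hΦ.zero]
  -- Uniqueness needs a right derivative at the left endpoint, where only continuity is given; it is
  -- the limit of the interior derivatives.
  have hright : HasDerivWithinAt γ (W (γ a)) (Ici a) a := by
    refine hasDerivWithinAt_Ici_of_tendsto_deriv (s := Ioo a b)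
      (fun t ht => (hγ' t ht).differentiableAt.differentiableWithinAt)
      ((hγ a ⟨le_rfl, hab.le⟩).mono Ioo_subset_Icc_self) (Ioo_mem_nhdsGT hab) ?_
    have h1 : Tendsto γ (𝓝[>] a) (𝓝 (γ a)) := by
      have := (hγ a ⟨le_rfl, hab.le⟩).mono Ioo_subset_Icc_self
      rwa [ContinuousWithinAt, nhdsWithin_Ioo_eq_nhdsGT hab] at this
    refine ((hK.continuous.tendsto (γ a)).comp h1).congr' ?_
    filter_upwards [Ioo_mem_nhdsGT hab] with t ht using (hγ' t ht).deriv.symm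
  refine ODE_solution_unique (v := fun _ => W) (fun _ => hK) hγ (fun t ht => ?_)
    ((hΦ.continuous_time (γ a)).comp (continuous_id.sub continuous_const)).continuousOn
    (fun t _ => ?_) (by simp [hΦ.zero])
  · rcases eq_or_lt_of_le ht.1 with rfl | hat
    · exact hright
    · exact (hγ' t ⟨hat, ht.2⟩).hasDerivWithinAt
  · exact ((hΦ.hasDerivAt (γ a) (t - a)).comp_sub_const t a).hasDerivWithinAt

/-- A continuous curve that follows the vector field as long as it lies in the open set `N`
agrees with the flow as long as the flow stays in `N`. -/
theorem eqOn_of_forall_mem (hΦ : IsGlobalFlow W Φ) (hK : LipschitzWith K W) {N : Set E}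
    (hN : IsOpen N) {γ : ℝ → E} {a b : ℝ} (hγ : ContinuousOn γ (Icc a b))
    (hγ' : ∀ t ∈ Ioo a b, γ t ∈ N → HasDerivAt γ (W (γ t)) t)
    (hmem : ∀ t ∈ Icc a b, Φ (t - a) (γ a) ∈ N) :
    ∀ t ∈ Icc a b, γ t = Φ (t - a) (γ a) := by
  have hflow : Continuous fun t => Φ (t - a) (γ a) :=
    (hΦ.continuous_time (γ a)).comp (continuous_id.sub continuous_const)
  rcases lt_or_ge b a with hab | hab
  · intro t ht
    exact absurd (ht.1.trans ht.2) hab.not_ge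
  -- Continuous induction: agreement is a closed condition, and agreement at `t` puts `γ` in the
  -- open set `N` for a while longer, where uniqueness extends it.
  have hsub : Icc a b ⊆ {t | γ t = Φ (t - a) (γ a)} := by
    refine IsClosed.Icc_subset_of_forall_mem_nhdsWithin ?_ (by simp [hΦ.zero]) ?_
    · rw [inter_comm]
      exact (isClosed_Icc.isClosed_eq hγ hflow.continuousOn)
    · rintro t ⟨ht, hta, htb⟩
      have htN : γ t ∈ N := by
        rw [show γ t = _ from ht]
        exact hmem t ⟨hta, htb.le⟩
      have hnear : ∀ᶠ s in 𝓝[>] t, γ s ∈ N := by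
        have h1 : ContinuousWithinAt γ (Ioo t b) t :=
          (hγ t ⟨hta, htb.le⟩).mono fun s hs => ⟨hta.trans hs.1.le, hs.2.le⟩
        rw [ContinuousWithinAt, nhdsWithin_Ioo_eq_nhdsGT htb] at h1
        exact h1.eventually (hN.mem_nhds htN)
      obtain ⟨c, hc, hcN⟩ := (mem_nhdsGT_iff_exists_Ioo_subset' htb).1
        (hnear.and (Ioo_mem_nhdsGT htb))
      have hcb : ∀ s ∈ Ioo t c, s ∈ Ioo t b := fun s hs => (hcN hs).2
      refine mem_of_superset (Ioo_mem_nhdsGT hc) fun s hs => ?_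
      have hsb := (hcb s hs).2
      have := hΦ.eqOn_of_hasDerivAt hK (γ := γ) (a := t) (b := s)
        (hγ.mono fun u hu => ⟨hta.trans hu.1, hu.2.trans hsb.le⟩)
        (fun u hu => hγ' u ⟨hta.trans_lt hu.1, hu.2.trans hsb⟩
          (hcN ⟨hu.1, hu.2.trans hs.2⟩).1) s ⟨hs.1.le, le_rfl⟩
      change γ s = _
      rw [this, show γ t = _ from ht, ← hΦ.add hK, sub_add_sub_cancel]
  exact hsub

end IsGlobalFlow

end GlobalFlow

/-! ### Cutting off a field near a compact set -/

section CutOff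

open Set
open scoped NNReal Manifold

/-- A `C¹` vector field on an open set of a finite-dimensional space coincides, near a compact
subset, with a Lipschitz `C¹` vector field that has a global flow. -/
theorem exists_isGlobalFlow_eqOn {E : Type*} [NormedAddCommGroup E] [NormedSpace ℝ E]
    [FiniteDimensional ℝ E] {w : E → E} {U C : Set E} (hU : IsOpen U) (hw : ContDiffOn ℝ 1 w U)
    (hC : IsCompact C) (hCU : C ⊆ U) :
    ∃ (W : E → E) (Φ : ℝ → E → E) (K : ℝ≥0) (N : Set E), IsGlobalFlow W Φ ∧ LipschitzWith K W ∧
      ContDiff ℝ 1 W ∧ IsOpen N ∧ C ⊆ N ∧ N ⊆ U ∧ EqOn W w N := by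
  have : CompleteSpace E := FiniteDimensional.complete ℝ E
  obtain ⟨L, hL, hCL, hLU⟩ := exists_compact_between hC hU hCU
  obtain ⟨f, hf1, hf0, -⟩ := exists_contMDiffMap_one_nhds_of_subset_interior (n := 1) 𝓘(ℝ, E)
    hC.isClosed hCL
  obtain ⟨N, hN, hCN, hN1⟩ := mem_nhdsSet_iff_exists.1 hf1
  have hf : ContDiff ℝ 1 f := f.contMDiff.contDiff
  have hW : ContDiff ℝ 1 fun x => f x • w x := by
    refine contDiff_iff_contDiffAt.2 fun x => ?_
    by_cases hx : x ∈ U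
    · exact hf.contDiffAt.smul (hw.contDiffAt (hU.mem_nhds hx))
    · refine (contDiffAt_const (c := (0 : E))).congr_of_eventuallyEq ?_
      filter_upwards [hL.isClosed.isOpen_compl.mem_nhds fun h => hx (hLU h)] with y hy
      rw [hf0 y hy, zero_smul]
  have hsupp : HasCompactSupport fun x => f x • w x :=
    HasCompactSupport.intro hL fun x hx => by rw [hf0 x hx, zero_smul]
  obtain ⟨K, hK⟩ := hW.lipschitzWith_of_hasCompactSupport hsupp one_ne_zero
  obtain ⟨B, hB⟩ := hsupp.exists_bound_of_continuous hW.continuous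
  obtain ⟨Φ, hΦ⟩ := exists_isGlobalFlow hK (L := B.toNNReal)
    fun x => (hB x).trans (Real.le_coe_toNNReal B)
  refine ⟨_, Φ, K, N ∩ U, hΦ, hK, hW, hN.inter hU, subset_inter hCN hCU, inter_subset_right,
    fun x hx => ?_⟩
  have : f x = 1 := hN1 hx.1
  simp [this]

end CutOff

/-! ### Smoothness of matrix inverses -/

section MatrixInverse

variable {E : Type*} [NormedAddCommGroup E] [NormedSpace ℝ E] {ι : Type*} [Fintype ι]
  [DecidableEq ι] {k : WithTop ℕ∞}

theorem ContDiffAt.matrix_det {A : E → Matrix ι ι ℝ} {x : E}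
    (hA : ∀ i j, ContDiffAt ℝ k (fun y => A y i j) x) : ContDiffAt ℝ k (fun y => (A y).det) x := by
  simp only [Matrix.det_apply]
  refine ContDiffAt.sum fun σ _ => ?_
  exact (contDiffAt_prod fun i _ => hA (σ i) i).const_smul _

/-- Cramer's rule: the entries are quotients of determinants, hence of polynomials in the entries of
`A`. -/
theorem ContDiffAt.matrix_inv {A : E → Matrix ι ι ℝ} {x : E}
    (hA : ∀ i j, ContDiffAt ℝ k (fun y => A y i j) x) (hx : IsUnit (A x).det) (i j : ι) :
    ContDiffAt ℝ k (fun y => (A y)⁻¹ i j) x := by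
  simp only [Matrix.inv_def, Ring.inverse_eq_inv', Matrix.smul_apply, Matrix.adjugate_apply]
  refine ((ContDiffAt.matrix_det hA).inv hx.ne_zero).smul (ContDiffAt.matrix_det fun a b => ?_)
  by_cases h : a = j
  · subst h
    simpa using contDiffAt_const
  · simpa [Matrix.updateRow_ne h] using hA a b

theorem ContDiffAt.matrix_inv_mulVec {A : E → Matrix ι ι ℝ} {b : E → ι → ℝ} {x : E}
    (hA : ∀ i j, ContDiffAt ℝ k (fun y => A y i j) x) (hb : ContDiffAt ℝ k b x)
    (hx : IsUnit (A x).det) : ContDiffAt ℝ k (fun y => (A y)⁻¹.mulVec (b y)) x := by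
  refine contDiffAt_pi.2 fun i => ?_
  simp only [Matrix.mulVec, dotProduct]
  exact ContDiffAt.sum fun j _ => (ContDiffAt.matrix_inv hA hx i j).mul (contDiffAt_pi.1 hb j)

end MatrixInverse

theorem jacobianMatrix_mulVec {a b : ℕ} (f : (Fin a → ℝ) → (Fin b → ℝ)) (x y : Fin a → ℝ) :
    (jacobianMatrix f x).mulVec y = fderiv ℝ f x y :=
  LinearMap.toMatrix'_mulVec _ _

theorem jacobianMatrix_apply {a b : ℕ} (f : (Fin a → ℝ) → (Fin b → ℝ)) (x : Fin a → ℝ)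
    (i : Fin b) (j : Fin a) : jacobianMatrix f x i j = fderiv ℝ f x (Pi.single j 1) i := by
  rw [← jacobianMatrix_mulVec, Matrix.mulVec_single_one]
  rfl

/-- Time, position, velocity and parameters, gathered into one state of an autonomous system. -/
abbrev ExtendedState (n p : ℕ) : Type := ℝ × (Fin n → ℝ) × (Fin n → ℝ) × (Fin p → ℝ)

/-! ### Reduction of the constrained equations to a vector field -/

namespace MultibodySystem

variable {n m p : ℕ} (S : MultibodySystem n m p)

/-- The constraint function in uncurried form. -/
def constrFun (z : ℝ × (Fin n → ℝ) × (Fin p → ℝ)) : Fin m → ℝ := S.constr z.1 z.2.1 z.2.2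

theorem contDiff_constrFun : ContDiff ℝ ∞ S.constrFun := S.constr_smooth

theorem hasFDerivAt_constrFun (z : ℝ × (Fin n → ℝ) × (Fin p → ℝ)) :
    HasFDerivAt S.constrFun (fderiv ℝ S.constrFun z) z :=
  (S.contDiff_constrFun.differentiable (by simp) z).hasFDerivAt

/-- Together with its analogues for `ρ` and `t`, this reduces all partial Jacobians to one total
derivative, to which the chain rule applies. -/
theorem constrQ_mulVec (t : ℝ) (q : Fin n → ℝ) (ρ : Fin p → ℝ) (a : Fin n → ℝ) :
    (S.constrQ t q ρ).mulVec a = fderiv ℝ S.constrFun (t, q, ρ) (0, a, 0) := by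
  have h := (hasFDerivAt_const (𝕜 := ℝ) t q).prodMk ((hasFDerivAt_id q).prodMk (hasFDerivAt_const ρ q))
  rw [constrQ, jacobianMatrix_mulVec]
  exact DFunLike.congr_fun ((S.hasFDerivAt_constrFun (t, q, ρ)).comp q h).fderiv a

theorem constrRho_mulVec (t : ℝ) (q : Fin n → ℝ) (ρ : Fin p → ℝ) (b : Fin p → ℝ) :
    (S.constrRho t q ρ).mulVec b = fderiv ℝ S.constrFun (t, q, ρ) (0, 0, b) := by
  have h := (hasFDerivAt_const (𝕜 := ℝ) t ρ).prodMk ((hasFDerivAt_const q ρ).prodMk (hasFDerivAt_id ρ))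
  rw [constrRho, jacobianMatrix_mulVec]
  exact DFunLike.congr_fun ((S.hasFDerivAt_constrFun (t, q, ρ)).comp ρ h).fderiv b

theorem constrT_eq (t : ℝ) (q : Fin n → ℝ) (ρ : Fin p → ℝ) :
    S.constrT t q ρ = fderiv ℝ S.constrFun (t, q, ρ) (1, 0, 0) := by
  have h : HasDerivAt (fun s : ℝ => (s, q, ρ)) (1, 0, 0) t :=
    (hasDerivAt_id t).prodMk ((hasDerivAt_const t q).prodMk (hasDerivAt_const t ρ))
  exact ((S.hasFDerivAt_constrFun (t, q, ρ)).comp_hasDerivAt t h).deriv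

theorem constrQ_apply (t : ℝ) (q : Fin n → ℝ) (ρ : Fin p → ℝ) (i : Fin m) (j : Fin n) :
    S.constrQ t q ρ i j = fderiv ℝ S.constrFun (t, q, ρ) (0, Pi.single j 1, 0) i := by
  rw [← constrQ_mulVec, Matrix.mulVec_single_one]
  rfl

theorem contDiff_fderiv_constrFun_apply {E : Type*} [NormedAddCommGroup E] [NormedSpace ℝ E]
    {g d : E → ℝ × (Fin n → ℝ) × (Fin p → ℝ)} (hg : ContDiff ℝ ∞ g) (hd : ContDiff ℝ ∞ d) :
    ContDiff ℝ ∞ fun y => fderiv ℝ S.constrFun (g y) (d y) :=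
  ((S.contDiff_constrFun.fderiv_right (m := ∞) (by simp)).comp hg).clm_apply hd

theorem contDiff_constrQ_apply (i : Fin m) (j : Fin n) : ContDiff ℝ ∞
    fun z : ℝ × (Fin n → ℝ) × (Fin p → ℝ) => S.constrQ z.1 z.2.1 z.2.2 i j := by
  simp only [constrQ_apply]
  exact contDiff_pi.1 (S.contDiff_fderiv_constrFun_apply contDiff_id contDiff_const) i

theorem contDiff_constrT : ContDiff ℝ ∞
    fun z : ℝ × (Fin n → ℝ) × (Fin p → ℝ) => S.constrT z.1 z.2.1 z.2.2 := by
  simp only [constrT_eq]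
  exact S.contDiff_fderiv_constrFun_apply contDiff_id contDiff_const

/-- The point `(t, q, ρ)` of an extended state `(t, q, v, ρ)`. -/
def configuration (X : ExtendedState n p) : ℝ × (Fin n → ℝ) × (Fin p → ℝ) :=
  (X.1, X.2.1, X.2.2.2)

theorem contDiff_configuration :
    ContDiff ℝ ∞ (configuration : ExtendedState n p → ℝ × (Fin n → ℝ) × (Fin p → ℝ)) := by
  unfold configuration
  fun_prop

/-- The total time derivative `Φ_t + Φ_q v` of the constraint function. -/
noncomputable def constrRate (X : ExtendedState n p) : Fin m → ℝ :=
  fderiv ℝ S.constrFun (configuration X) (1, X.2.2.1, 0)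

theorem contDiff_constrRate : ContDiff ℝ ∞ S.constrRate :=
  S.contDiff_fderiv_constrFun_apply contDiff_configuration (by fun_prop)

/-- The rate `Φ_t + Φ_q v` is affine in `v` with linear part `Φ_q`. This isolates the acceleration
in the second time derivative of the constraint. -/
theorem fderiv_constrRate_velocity (X : ExtendedState n p) (a : Fin n → ℝ) :
    fderiv ℝ S.constrRate X (0, 0, a, 0) =
      (S.constrQ X.1 X.2.1 X.2.2.2).mulVec a := by
  have hline : HasDerivAt (fun s : ℝ => X + s • ((0, 0, a, 0) : ExtendedState n p))
      (0, 0, a, 0) 0 := by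
    simpa using ((hasDerivAt_id (0 : ℝ)).smul_const
      ((0, 0, a, 0) : ExtendedState n p)).const_add X
  have h1 : HasDerivAt (fun s : ℝ => S.constrRate (X + s • ((0, 0, a, 0) : ExtendedState n p)))
      (fderiv ℝ S.constrRate X (0, 0, a, 0)) 0 := by
    have h0 : HasFDerivAt S.constrRate (fderiv ℝ S.constrRate X)
        (X + (0 : ℝ) • ((0, 0, a, 0) : ExtendedState n p)) := by
      simpa using (S.contDiff_constrRate.differentiable (by simp) X).hasFDerivAt
    exact h0.comp_hasDerivAt (0 : ℝ) hline
  have h2 : HasDerivAt (fun s : ℝ => S.constrRate X +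
      s • fderiv ℝ S.constrFun (configuration X) (0, a, 0))
      (fderiv ℝ S.constrFun (configuration X) (0, a, 0)) 0 := by
    simpa using ((hasDerivAt_id (0 : ℝ)).smul_const
      (fderiv ℝ S.constrFun (configuration X) (0, a, 0))).const_add (S.constrRate X)
  rw [constrQ_mulVec]
  refine h1.unique (h2.congr_of_eventuallyEq (Eventually.of_forall fun s => ?_))
  simp only [constrRate, configuration, ← map_smul, ← map_add]
  simp

/-- The right-hand side of the equations of motion in index-1 form. -/
noncomputable def augmentedRhs (X : ExtendedState n p) : Fin n ⊕ Fin m → ℝ :=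
  Sum.elim (S.force X.1 X.2.1 X.2.2.1 X.2.2.2) (-fderiv ℝ S.constrRate X (1, X.2.2.1, 0, 0))

/-- The acceleration determined by the equations of motion in index-1 form. -/
noncomputable def acceleration (X : ExtendedState n p) : Fin n → ℝ :=
  fun i => ((S.augmentedMatrix X.1 X.2.1 X.2.2.2)⁻¹.mulVec (S.augmentedRhs X)) (Sum.inl i)

/-- The states at which the equations of motion in index-1 form are regular. -/
def regularSet : Set (ExtendedState n p) :=
  {X | IsUnit (S.augmentedMatrix X.1 X.2.1 X.2.2.2).det}

/-- The vector field of the equations of motion on the extended state space. -/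
noncomputable def vectorField (X : ExtendedState n p) : ExtendedState n p :=
  (1, X.2.2.1, S.acceleration X, 0)

theorem contDiff_augmentedMatrix_apply (i j : Fin n ⊕ Fin m) : ContDiff ℝ ∞
    fun X : ExtendedState n p => S.augmentedMatrix X.1 X.2.1 X.2.2.2 i j := by
  have hQ : ∀ i j, ContDiff ℝ ∞ fun X : ExtendedState n p => S.constrQ X.1 X.2.1 X.2.2.2 i j :=
    fun i j => (S.contDiff_constrQ_apply i j).comp contDiff_configuration
  rcases i with i | i <;> rcases j with j | j
  · exact (S.mass_smooth i j).comp contDiff_configuration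
  · exact hQ j i
  · exact hQ i j
  · exact contDiff_const

theorem isOpen_regularSet : IsOpen S.regularSet := by
  have hdet : Continuous fun X : ExtendedState n p =>
      (S.augmentedMatrix X.1 X.2.1 X.2.2.2).det := by
    refine continuous_iff_continuousAt.2 fun X => ?_
    exact (ContDiffAt.matrix_det fun i j =>
      (S.contDiff_augmentedMatrix_apply i j).contDiffAt).continuousAt
  simp only [regularSet, isUnit_iff_ne_zero]
  exact isOpen_ne.preimage hdet

theorem contDiff_augmentedRhs : ContDiff ℝ ∞ S.augmentedRhs := by
  refine contDiff_pi.2 fun i => ?_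
  rcases i with i | i
  · exact contDiff_pi.1 S.force_smooth i
  · have h1 : ContDiff ℝ ∞ fun X : ExtendedState n p =>
        fderiv ℝ S.constrRate X (1, X.2.2.1, 0, 0) :=
      (S.contDiff_constrRate.fderiv_right (m := ∞) (by simp)).clm_apply (by fun_prop)
    exact (contDiff_pi.1 h1 i).neg

theorem contDiffOn_vectorField : ContDiffOn ℝ ∞ S.vectorField S.regularSet := by
  intro X hX
  refine ContDiffAt.contDiffWithinAt ?_
  have hacc : ContDiffAt ℝ ∞ S.acceleration X :=
    contDiffAt_pi.2 fun i => contDiffAt_pi.1 (ContDiffAt.matrix_inv_mulVec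
      (fun i j => (S.contDiff_augmentedMatrix_apply i j).contDiffAt)
      S.contDiff_augmentedRhs.contDiffAt hX) (Sum.inl i)
  have hv : ContDiffAt ℝ ∞ (fun X : ExtendedState n p => X.2.2.1) X := by fun_prop
  exact contDiffAt_const.prodMk (hv.prodMk (hacc.prodMk contDiffAt_const))

variable {S}

/-- A curve that solves the equations of motion near `t` follows the vector field at `t`, as long
as its state is regular. -/
theorem SolvesAt.hasDerivAt_extendedState {ρ : Fin p → ℝ} {q v : ℝ → Fin n → ℝ} {t : ℝ}
    (h : ∀ᶠ s in 𝓝 t, S.SolvesAt ρ q v s) (hreg : (t, q t, v t, ρ) ∈ S.regularSet) :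
    HasDerivAt (fun s => (s, q s, v s, ρ)) (S.vectorField (t, q t, v t, ρ)) t := by
  -- The rate must vanish on a neighbourhood of `t`, since it is differentiated once more to obtain
  -- the acceleration constraint.
  have hrate : ∀ᶠ s in 𝓝 t, S.constrRate (s, q s, v s, ρ) = 0 := by
    filter_upwards [h.eventually_nhds] with s hs
    have hc : HasDerivAt (fun u => (u, q u, ρ)) (1, v s, 0) s :=
      (hasDerivAt_id s).prodMk (hs.self_of_nhds.1.prodMk (hasDerivAt_const s ρ))
    have h1 := (S.hasFDerivAt_constrFun (s, q s, ρ)).comp_hasDerivAt s hc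
    have h2 : HasDerivAt (S.constrFun ∘ fun u => (u, q u, ρ)) 0 s :=
      (hasDerivAt_const s (0 : Fin m → ℝ)).congr_of_eventuallyEq (by
        filter_upwards [hs] with u hu using hu.2.2)
    exact h1.unique h2
  obtain ⟨hq, ⟨a, lam, ha, hM⟩, -⟩ := h.self_of_nhds
  have hX : HasDerivAt (fun s => (s, q s, v s, ρ)) (1, v t, a, 0) t :=
    (hasDerivAt_id t).prodMk (hq.prodMk (ha.prodMk (hasDerivAt_const t ρ)))
  have h0 : fderiv ℝ S.constrRate (t, q t, v t, ρ) (1, v t, a, 0) = 0 := by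
    have h1 := HasFDerivAt.comp_hasDerivAt t (S.contDiff_constrRate.differentiable (by simp)
      (t, q t, v t, ρ)).hasFDerivAt hX
    exact h1.unique ((hasDerivAt_const t (0 : Fin m → ℝ)).congr_of_eventuallyEq hrate)
  have hQa : (S.constrQ t (q t) ρ).mulVec a =
      -fderiv ℝ S.constrRate (t, q t, v t, ρ) (1, v t, 0, 0) := by
    have hsum : ((1, v t, a, 0) : ExtendedState n p) = (1, v t, 0, 0) + (0, 0, a, 0) := by simp
    rw [hsum, map_add, fderiv_constrRate_velocity] at h0
    exact eq_neg_of_add_eq_zero_right h0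
  -- The multiplier enters with a minus sign because the augmented matrix has `Φ_qᵀ` on the
  -- left-hand side.
  have haug : (S.augmentedMatrix t (q t) ρ).mulVec (Sum.elim a (-lam)) =
      S.augmentedRhs (t, q t, v t, ρ) := by
    rw [augmentedMatrix, Matrix.fromBlocks_mulVec, augmentedRhs]
    congr 1
    · simp [hM, Matrix.mulVec_neg]
    · simp [hQa]
  have hacc : S.acceleration (t, q t, v t, ρ) = a := by
    funext i
    change ((S.augmentedMatrix t (q t) ρ)⁻¹.mulVec (S.augmentedRhs (t, q t, v t, ρ))) _ = _
    rw [← haug, Matrix.mulVec_mulVec, Matrix.nonsing_inv_mul _ hreg, Matrix.one_mulVec]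
    rfl
  rw [vectorField, hacc]
  exact hX

end MultibodySystem

/-! ### Continuity and differentiability of the event time -/

section EventTime

open Set

/-- The first zero of a perturbed scalar function tends to a transversal first zero of the
nominal one. -/
theorem tendsto_firstZero {E P : Type*} [TopologicalSpace E] [TopologicalSpace P]
    {g : ℝ → E → ℝ} (hg : Continuous fun z : ℝ × E => g z.1 z.2) {ξ : P → E} {ρ : P}
    (hξ : ContinuousAt ξ ρ) {τ : P → ℝ} {t₀ c δ : ℝ} (hδ : 0 < δ) (ht₀ : t₀ < τ ρ) (hc : c ≠ 0)
    (hd : HasDerivAt (fun s => g s (ξ ρ)) c (τ ρ)) (h0 : g (τ ρ) (ξ ρ) = 0)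
    (hne : ∀ s ∈ Ico t₀ (τ ρ), g s (ξ ρ) ≠ 0)
    (hev : ∀ᶠ ρ' in 𝓝 ρ, t₀ < τ ρ' ∧ (∀ s ∈ Ico t₀ (τ ρ'), s ≤ τ ρ + δ → g s (ξ ρ') ≠ 0) ∧
      (τ ρ' ≤ τ ρ + δ → g (τ ρ') (ξ ρ') = 0)) :
    Tendsto τ (𝓝 ρ) (𝓝 (τ ρ)) := by
  have hg' : ∀ s, ContinuousAt (fun ρ' => g s (ξ ρ')) ρ := fun s =>
    ContinuousAt.comp (f := fun ρ' => (s, ξ ρ')) hg.continuousAt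
      (continuousAt_const.prodMk hξ)
  have hc2 : 0 < c * c := mul_self_pos.2 hc
  obtain ⟨κ, hκ, hlin⟩ := Metric.eventually_nhds_iff.1
    ((hasDerivAt_iff_isLittleO.1 hd).def (half_pos (abs_pos.2 hc)))
  refine Metric.tendsto_nhds.2 fun ε hε => ?_
  obtain ⟨η, hη0, hη⟩ := exists_between (show 0 < min (min ε δ) (min κ (τ ρ - t₀)) by
    have := sub_pos.2 ht₀
    positivity)
  have hηε : η < ε := hη.trans_le ((min_le_left _ _).trans (min_le_left _ _))
  have hηδ : η < δ := hη.trans_le ((min_le_left _ _).trans (min_le_right _ _))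
  have hηκ : η < κ := hη.trans_le ((min_le_right _ _).trans (min_le_left _ _))
  have hηt : η < τ ρ - t₀ := hη.trans_le ((min_le_right _ _).trans (min_le_right _ _))
  have hcc : |c| * |c| = c * c := abs_mul_abs_self c
  -- Multiplying by `c` turns the slope into `c * c > 0`, so the sign of `c` needs no case
  -- distinction.
  have hscale : ∀ y d : ℝ, ‖y - 0 - d * c‖ ≤ |c| / 2 * ‖d‖ →
      |c * y - d * (c * c)| ≤ c * c / 2 * |d| := fun y d hyd => by
    have h1 : c * y - d * (c * c) = c * (y - 0 - d * c) := by ring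
    rw [h1, abs_mul]
    calc |c| * |y - 0 - d * c| ≤ |c| * (|c| / 2 * |d|) := by gcongr; exact hyd
      _ = c * c / 2 * |d| := by rw [← hcc]; ring
  have hpos : 0 < c * g (τ ρ + η) (ξ ρ) := by
    have h1 := hscale _ _ (by
      simpa [h0, abs_of_pos hη0] using hlin (y := τ ρ + η) (by
        rw [Real.dist_eq, add_sub_cancel_left, abs_of_pos hη0]; exact hηκ) :
      ‖g (τ ρ + η) (ξ ρ) - 0 - η * c‖ ≤ |c| / 2 * ‖η‖)
    rw [abs_of_pos hη0] at h1
    have := (abs_le.1 h1).1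
    nlinarith [mul_pos hη0 hc2]
  have hneg : c * g (τ ρ - η) (ξ ρ) < 0 := by
    have h1 := hscale _ _ (by
      simpa [h0, abs_of_pos hη0] using hlin (y := τ ρ - η) (by
        rw [Real.dist_eq, sub_sub_cancel_left, abs_neg, abs_of_pos hη0]; exact hηκ) :
      ‖g (τ ρ - η) (ξ ρ) - 0 - (-η) * c‖ ≤ |c| / 2 * ‖-η‖)
    rw [abs_neg, abs_of_pos hη0] at h1
    have := (abs_le.1 h1).2
    nlinarith [mul_pos hη0 hc2]
  have epos : ∀ᶠ ρ' in 𝓝 ρ, 0 < c * g (τ ρ + η) (ξ ρ') :=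
    (continuousAt_const.mul (hg' _)).eventually (lt_mem_nhds hpos)
  have eneg : ∀ᶠ ρ' in 𝓝 ρ, c * g (τ ρ - η) (ξ ρ') < 0 :=
    (continuousAt_const.mul (hg' _)).eventually (gt_mem_nhds hneg)
  have ene : ∀ᶠ ρ' in 𝓝 ρ, ∀ s ∈ Icc t₀ (τ ρ - η), g s (ξ ρ') ≠ 0 := by
    refine isCompact_Icc.eventually_forall_of_forall_eventually fun s hs => ?_
    have h1 : ContinuousAt (fun z : P × ℝ => g z.2 (ξ z.1)) (ρ, s) :=
      ContinuousAt.comp (f := fun z : P × ℝ => (z.2, ξ z.1)) hg.continuousAt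
        (continuousAt_snd.prodMk (ContinuousAt.comp (f := Prod.fst) hξ continuousAt_fst))
    exact h1.eventually_ne (hne s ⟨hs.1, hs.2.trans_lt (by linarith)⟩)
  filter_upwards [hev, epos, eneg, ene] with ρ' ⟨hτ', hne', hzero⟩ hp hn hfar
  rw [Real.dist_eq, abs_lt]
  -- Compactness excludes zeros up to `τ ρ - η`, which gives the lower bound; the sign change across
  -- `τ ρ` gives the upper one.
  have hlow : τ ρ - η < τ ρ' := by
    by_contra! hle
    exact hfar _ ⟨hτ'.le, hle⟩ (hzero (by linarith))
  have hup : τ ρ' ≤ τ ρ + η := by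
    by_contra! hlt
    have hcont : ContinuousOn (fun s => c * g s (ξ ρ')) (Icc (τ ρ - η) (τ ρ + η)) := by
      have : Continuous fun s => g s (ξ ρ') := hg.comp (continuous_id.prodMk continuous_const)
      exact (continuous_const.mul this).continuousOn
    obtain ⟨s, hs, hs0⟩ := intermediate_value_Icc (by linarith) hcont ⟨hn.le, hp.le⟩
    refine hne' s ⟨by linarith [hs.1], by linarith [hs.2]⟩ (by linarith [hs.2]) ?_
    exact (mul_eq_zero.1 hs0).resolve_left hc
  constructor <;> linarith

/-- A continuous solution of a scalar equation whose partial derivative in the unknown does not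
vanish is differentiable. -/
theorem hasFDerivAt_of_implicit {P : Type*} [NormedAddCommGroup P] [NormedSpace ℝ P]
    {G : ℝ × P → ℝ} {τ : P → ℝ} {ρ : P} {c : ℝ} {L : P →L[ℝ] ℝ}
    (hG : HasFDerivAt G ((ContinuousLinearMap.toSpanSingleton ℝ c).coprod L) (τ ρ, ρ))
    (hc : c ≠ 0) (hτ : ContinuousAt τ ρ) (hzero : ∀ᶠ ρ' in 𝓝 ρ, G (τ ρ', ρ') = 0) :
    HasFDerivAt τ (-(c⁻¹ • L)) ρ := by
  have hz0 : G (τ ρ, ρ) = 0 := hzero.self_of_nhds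
  have hlim : Tendsto (fun ρ' => (τ ρ', ρ')) (𝓝 ρ) (𝓝 (τ ρ, ρ)) := hτ.prodMk continuousAt_id
  have h1 : (fun ρ' => τ ρ' - τ ρ - (-(c⁻¹ • L)) (ρ' - ρ)) =o[𝓝 ρ]
      fun ρ' => ((τ ρ', ρ') - (τ ρ, ρ) : ℝ × P) := by
    have h2 := ((hG.isLittleO.comp_tendsto hlim).const_mul_left (-c⁻¹))
    refine h2.congr' ?_ EventuallyEq.rfl
    filter_upwards [hzero] with ρ' hρ'
    simp only [Function.comp_apply, hρ', hz0, ContinuousLinearMap.coprod_apply, Prod.fst_sub,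
      Prod.snd_sub, ContinuousLinearMap.toSpanSingleton_apply, smul_eq_mul,
      neg_apply, smul_apply]
    field_simp
    ring
  have h3 : (fun ρ' => ((τ ρ', ρ') - (τ ρ, ρ) : ℝ × P)) =O[𝓝 ρ] fun ρ' => ρ' - ρ := by
    -- The remainder is small relative to `(τ ρ' - τ ρ, ρ' - ρ)`. With factor `1 / 2`, half of `‖τ
    -- ρ' - τ ρ‖` is absorbed on the left, which doubles the constant.
    refine Asymptotics.IsBigO.of_bound (2 * (‖-(c⁻¹ • L)‖ + 1)) ?_
    filter_upwards [h1.def (half_pos one_pos)] with ρ' hρ'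
    have h4 : ‖τ ρ' - τ ρ‖ ≤ ‖τ ρ' - τ ρ - (-(c⁻¹ • L)) (ρ' - ρ)‖ +
        ‖-(c⁻¹ • L)‖ * ‖ρ' - ρ‖ :=
      (norm_le_norm_sub_add _ ((-(c⁻¹ • L)) (ρ' - ρ))).trans
        (add_le_add le_rfl (ContinuousLinearMap.le_opNorm _ _))
    have h5 : ‖((τ ρ', ρ') - (τ ρ, ρ) : ℝ × P)‖ ≤ ‖τ ρ' - τ ρ‖ + ‖ρ' - ρ‖ := by
      rw [Prod.norm_def]
      exact max_le (le_add_of_nonneg_right (norm_nonneg _))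
        (le_add_of_nonneg_left (norm_nonneg _))
    nlinarith
  exact HasFDerivAt.of_isLittleO (h1.trans_isBigO h3)

end EventTime

/-! ### Parameter-dependent orbits and multibody motions as orbits -/

namespace IsGlobalFlow

open Set
open scoped NNReal

variable {E P : Type*} [NormedAddCommGroup E] [NormedSpace ℝ E] [CompleteSpace E]
  [NormedAddCommGroup P] [NormedSpace ℝ P] {W : E → E} {Φ : ℝ → E → E} {K : ℝ≥0}

/-- Derivative of the flow with respect to parameters on which the elapsed time and the initial
point depend. -/
theorem hasFDerivAt_comp (hΦ : IsGlobalFlow W Φ) (hK : LipschitzWith K W) (hW : ContDiff ℝ 1 W)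
    {s : P → ℝ} {ξ : P → E} {s' : P →L[ℝ] ℝ} {ξ' : P →L[ℝ] E} {ρ : P} (hs : HasFDerivAt s s' ρ)
    (hξ : HasFDerivAt ξ ξ' ρ) (h0 : 0 ≤ s ρ) :
    HasFDerivAt (fun ρ' => Φ (s ρ') (ξ ρ'))
      ((fderiv ℝ (Φ (s ρ)) (ξ ρ)).comp ξ' + s'.smulRight (W (Φ (s ρ) (ξ ρ)))) ρ := by
  have h1 := HasFDerivAt.comp (f := fun ρ' => (s ρ', ξ ρ')) ρ
    (hΦ.hasFDerivAt_uncurry hK hW (ξ ρ) h0) (hs.prodMk hξ)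
  refine h1.congr_fderiv ?_
  ext b
  simp [add_comm]

end IsGlobalFlow

section PhaseFlow

open Set
open scoped NNReal

variable {n m p : ℕ}

/-- The flow `Φ` of the Lipschitz field `W` describes the motion of the multibody system `S` as
long as the extended state lies in the open set `N`. -/
structure IsPhaseFlow (S : MultibodySystem n m p) (W : ExtendedState n p → ExtendedState n p)
    (Φ : ℝ → ExtendedState n p → ExtendedState n p) (K : ℝ≥0) (N : Set (ExtendedState n p)) :
    Prop where
  flow : IsGlobalFlow W Φ
  lipschitz : LipschitzWith K W
  contDiff : ContDiff ℝ 1 W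
  isOpen : IsOpen N
  subset : N ⊆ S.regularSet
  eqOn : EqOn W S.vectorField N

variable {S : MultibodySystem n m p} {ρ : Fin p → ℝ} {q v : ℝ → Fin n → ℝ} {a b : ℝ}

theorem continuousOn_extendedState (hq : ContinuousOn q (Icc a b)) (hv : ContinuousOn v (Icc a b)) :
    ContinuousOn (fun s => ((s, q s, v s, ρ) : ExtendedState n p)) (Icc a b) :=
  continuousOn_id.prodMk (hq.prodMk (hv.prodMk continuousOn_const))

/-- The states over a compact time interval form a compact subset of the open regular set, so the
cut-off applies. -/
theorem exists_isPhaseFlow (hq : ContinuousOn q (Icc a b)) (hv : ContinuousOn v (Icc a b))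
    (hreg : ∀ t ∈ Icc a b, IsUnit (S.augmentedMatrix t (q t) ρ).det) :
    ∃ W Φ K N, IsPhaseFlow S W Φ K N ∧ ∀ t ∈ Icc a b, (t, q t, v t, ρ) ∈ N := by
  obtain ⟨W, Φ, K, N, hΦ, hK, hW, hN, hCN, hNU, heq⟩ := exists_isGlobalFlow_eqOn
    S.isOpen_regularSet (S.contDiffOn_vectorField.of_le (by simp))
    (isCompact_Icc.image_of_continuousOn (continuousOn_extendedState (ρ := ρ) hq hv))
    (by rintro _ ⟨t, ht, rfl⟩; exact hreg t ht)
  exact ⟨W, Φ, K, N, ⟨hΦ, hK, hW, hN, hNU, heq⟩, fun t ht => hCN (mem_image_of_mem _ ht)⟩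

namespace IsPhaseFlow

variable {W : ExtendedState n p → ExtendedState n p}
  {Φ : ℝ → ExtendedState n p → ExtendedState n p} {K : ℝ≥0} {N : Set (ExtendedState n p)}

theorem hasDerivAt (hS : IsPhaseFlow S W Φ K N) (hsol : ∀ t ∈ Ioo a b, S.SolvesAt ρ q v t) {t : ℝ}
    (ht : t ∈ Ioo a b) (hN : (t, q t, v t, ρ) ∈ N) :
    HasDerivAt (fun s => (s, q s, v s, ρ)) (W (t, q t, v t, ρ)) t := by
  rw [hS.eqOn hN]
  exact MultibodySystem.SolvesAt.hasDerivAt_extendedState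
    (by filter_upwards [Ioo_mem_nhds ht.1 ht.2] with s hs using hsol s hs) (hS.subset hN)

/-- A solution with states in `N` is an orbit of the flow. -/
theorem eq_flow (hS : IsPhaseFlow S W Φ K N) (hq : ContinuousOn q (Icc a b))
    (hv : ContinuousOn v (Icc a b)) (hsol : ∀ t ∈ Ioo a b, S.SolvesAt ρ q v t)
    (hN : ∀ t ∈ Icc a b, (t, q t, v t, ρ) ∈ N) :
    ∀ t ∈ Icc a b, (t, q t, v t, ρ) = Φ (t - a) (a, q a, v a, ρ) :=
  hS.flow.eqOn_of_hasDerivAt hS.lipschitz (continuousOn_extendedState hq hv)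
    fun t ht => hS.hasDerivAt hsol ht (hN t ⟨ht.1.le, ht.2.le⟩)

/-- A solution is an orbit of the flow as long as the flow stays in `N`. -/
theorem eq_flow_of_flow_mem (hS : IsPhaseFlow S W Φ K N) (hq : ContinuousOn q (Icc a b))
    (hv : ContinuousOn v (Icc a b)) (hsol : ∀ t ∈ Ioo a b, S.SolvesAt ρ q v t)
    (hN : ∀ t ∈ Icc a b, Φ (t - a) (a, q a, v a, ρ) ∈ N) :
    ∀ t ∈ Icc a b, (t, q t, v t, ρ) = Φ (t - a) (a, q a, v a, ρ) :=
  hS.flow.eqOn_of_forall_mem hS.lipschitz hS.isOpen (continuousOn_extendedState hq hv)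
    (fun _ ht => hS.hasDerivAt hsol ht) hN

end IsPhaseFlow

end PhaseFlow

/-! ### One-sided velocities as continuous extensions -/

theorem MultibodySystem.SolvesAt.congr {n m p : ℕ} {S : MultibodySystem n m p} {ρ : Fin p → ℝ}
    {q v w : ℝ → Fin n → ℝ} {t : ℝ} (h : S.SolvesAt ρ q v t) (hw : w =ᶠ[𝓝 t] v) :
    S.SolvesAt ρ q w t := by
  obtain ⟨hq, ⟨a, lam, ha, hM⟩, hc⟩ := h
  rw [SolvesAt, hw.self_of_nhds]
  exact ⟨hq, ⟨a, lam, ha.congr_of_eventuallyEq hw, hM⟩, hc⟩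

theorem eventuallyEq_update_of_ne {X : Type*} (f : ℝ → X) {τ t : ℝ} (x : X) (h : t ≠ τ) :
    Function.update f τ x =ᶠ[𝓝 t] f := by
  filter_upwards [isOpen_ne.mem_nhds h] with s hs using Function.update_of_ne hs _ _

namespace IsHybridTrajectory

open Set

variable {n mMinus mPlus fMinus fPlus p : ℕ} {SMinus : MultibodySystem n mMinus p}
  {SPlus : MultibodySystem n mPlus p} {eMinus : Fin mMinus ⊕ Fin fMinus ≃ Fin n}
  {ePlus : Fin mPlus ⊕ Fin fPlus ≃ Fin n} {r : (Fin n → ℝ) → ℝ}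
  {h : ℝ → (Fin n → ℝ) → (Fin fMinus → ℝ) → (Fin p → ℝ) → (Fin fPlus → ℝ)}
  {t₀ tF : ℝ} {qInit vInit : Fin n → ℝ} {ρ : Fin p → ℝ} {q v : ℝ → (Fin n → ℝ)} {τ : ℝ}
  {vMinus vPlus : Fin n → ℝ}

/-- Since `v τ` is arbitrary, it is overwritten by the one-sided limit; the phase then becomes a
continuous curve on a closed interval. -/
theorem continuousOn_before (H : IsHybridTrajectory SMinus SPlus eMinus ePlus r h t₀ tF qInit vInit
    ρ q v τ vMinus vPlus) : ContinuousOn (Function.update v τ vMinus) (Icc t₀ τ) := by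
  rw [continuousOn_update_iff, Icc_sdiff_right]
  exact ⟨H.continuous_v_before, fun _ => H.tendsto_vMinus.mono_left
    (nhdsWithin_mono _ Ico_subset_Iio_self)⟩

theorem continuousOn_after (H : IsHybridTrajectory SMinus SPlus eMinus ePlus r h t₀ tF qInit vInit
    ρ q v τ vMinus vPlus) : ContinuousOn (Function.update v τ vPlus) (Icc τ tF) := by
  rw [continuousOn_update_iff, Icc_sdiff_left]
  exact ⟨H.continuous_v_after, fun _ => H.tendsto_vPlus.mono_left
    (nhdsWithin_mono _ Ioc_subset_Ioi_self)⟩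

theorem solvesAt_before (H : IsHybridTrajectory SMinus SPlus eMinus ePlus r h t₀ tF qInit vInit
    ρ q v τ vMinus vPlus) {t : ℝ} (ht : t ∈ Ioo t₀ τ) :
    SMinus.SolvesAt ρ q (Function.update v τ vMinus) t :=
  (H.solves_before t ht).congr (eventuallyEq_update_of_ne v _ ht.2.ne)

theorem solvesAt_after (H : IsHybridTrajectory SMinus SPlus eMinus ePlus r h t₀ tF qInit vInit
    ρ q v τ vMinus vPlus) {t : ℝ} (ht : t ∈ Ioo τ tF) :
    SPlus.SolvesAt ρ q (Function.update v τ vPlus) t :=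
  (H.solves_after t ht).congr (eventuallyEq_update_of_ne v _ ht.1.ne')

theorem continuousOn_q_before (H : IsHybridTrajectory SMinus SPlus eMinus ePlus r h t₀ tF qInit
    vInit ρ q v τ vMinus vPlus) : ContinuousOn q (Icc t₀ τ) :=
  H.continuous_q.mono (Icc_subset_Icc_right H.event_mem.2.le)

theorem continuousOn_q_after (H : IsHybridTrajectory SMinus SPlus eMinus ePlus r h t₀ tF qInit
    vInit ρ q v τ vMinus vPlus) : ContinuousOn q (Icc τ tF) :=
  H.continuous_q.mono (Icc_subset_Icc_left H.event_mem.1.le)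

end IsHybridTrajectory

/-! ### The state right after the event -/

section Reset

variable {n m f k l p : ℕ}

/-- The matrix `[Φ_dep, Φ_dof; 0, 1]` that maps the dependent and independent velocities to the
constraint rate and the independent velocities. -/
noncomputable def MultibodySystem.partitionMatrix (S : MultibodySystem n m p)
    (e : Fin m ⊕ Fin f ≃ Fin n) (t : ℝ) (q : Fin n → ℝ) (ρ : Fin p → ℝ) :
    Matrix (Fin m ⊕ Fin f) (Fin m ⊕ Fin f) ℝ :=
  Matrix.fromBlocks (S.constrDep e t q ρ) (S.constrDof e t q ρ) 0 1

theorem MultibodySystem.isUnit_det_partitionMatrix {S : MultibodySystem n m p}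
    {e : Fin m ⊕ Fin f ≃ Fin n} {t : ℝ} {q : Fin n → ℝ} {ρ : Fin p → ℝ}
    (h : IsUnit (S.constrDep e t q ρ).det) : IsUnit (S.partitionMatrix e t q ρ).det := by
  simpa [partitionMatrix, Matrix.det_fromBlocks_zero₂₁] using h

theorem MultibodySystem.contDiff_partitionMatrix_apply (S : MultibodySystem n m p)
    (e : Fin m ⊕ Fin f ≃ Fin n) (i j : Fin m ⊕ Fin f) : ContDiff ℝ ∞
      fun X : ExtendedState n p => S.partitionMatrix e X.1 X.2.1 X.2.2.2 i j := by
  rcases i with i | i <;> rcases j with j | j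
  · exact (S.contDiff_constrQ_apply i (e (Sum.inl j))).comp contDiff_configuration
  · exact (S.contDiff_constrQ_apply i (e (Sum.inr j))).comp contDiff_configuration
  · exact contDiff_const
  · exact contDiff_const

theorem MultibodySystem.constrQ_mulVec_partition (S : MultibodySystem n m p)
    (e : Fin m ⊕ Fin f ≃ Fin n) (t : ℝ) (q : Fin n → ℝ) (ρ : Fin p → ℝ) (x : Fin n → ℝ) :
    (S.constrQ t q ρ).mulVec x = (S.constrDep e t q ρ).mulVec (fun i => x (e (Sum.inl i))) +
      (S.constrDof e t q ρ).mulVec (dofVec e x) := by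
  funext i
  simp only [Matrix.mulVec, dotProduct, Pi.add_apply]
  rw [← e.sum_comp, Fintype.sum_sum_type]
  rfl

/-- The velocity after the event, as a function of the extended state right before it. -/
noncomputable def resetVelocity (S : MultibodySystem n m p) (e : Fin m ⊕ Fin f ≃ Fin n)
    (e' : Fin k ⊕ Fin l ≃ Fin n)
    (h : ℝ → (Fin n → ℝ) → (Fin l → ℝ) → (Fin p → ℝ) → (Fin f → ℝ)) (X : ExtendedState n p) :
    Fin n → ℝ :=
  fun i => ((S.partitionMatrix e X.1 X.2.1 X.2.2.2)⁻¹.mulVec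
    (Sum.elim (-S.constrT X.1 X.2.1 X.2.2.2) (h X.1 X.2.1 (dofVec e' X.2.2.1) X.2.2.2)))
    (e.symm i)

theorem contDiffAt_resetVelocity {S : MultibodySystem n m p} {e : Fin m ⊕ Fin f ≃ Fin n}
    {e' : Fin k ⊕ Fin l ≃ Fin n}
    {h : ℝ → (Fin n → ℝ) → (Fin l → ℝ) → (Fin p → ℝ) → (Fin f → ℝ)}
    (hh : ContDiff ℝ ∞ (fun x : ℝ × (Fin n → ℝ) × (Fin l → ℝ) × (Fin p → ℝ) =>
      h x.1 x.2.1 x.2.2.1 x.2.2.2)) {X : ExtendedState n p}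
    (hX : IsUnit (S.constrDep e X.1 X.2.1 X.2.2.2).det) :
    ContDiffAt ℝ ∞ (resetVelocity S e e' h) X := by
  refine contDiffAt_pi.2 fun i => contDiffAt_pi.1 (ContDiffAt.matrix_inv_mulVec
    (fun i j => (S.contDiff_partitionMatrix_apply e i j).contDiffAt) (ContDiff.contDiffAt ?_)
    (MultibodySystem.isUnit_det_partitionMatrix hX)) (e.symm i)
  refine contDiff_pi.2 fun i => ?_
  rcases i with i | i
  · exact (contDiff_pi.1 (S.contDiff_constrT.comp MultibodySystem.contDiff_configuration) i).neg
  · have hd : ContDiff ℝ ∞ fun X : ExtendedState n p => dofVec e' X.2.2.1 :=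
      contDiff_pi.2 fun j => contDiff_pi.1 (contDiff_fst.comp (contDiff_snd.comp contDiff_snd)) _
    exact contDiff_pi.1 (hh.comp (contDiff_fst.prodMk ((contDiff_fst.comp contDiff_snd).prodMk
      (hd.prodMk (contDiff_snd.comp (contDiff_snd.comp contDiff_snd)))))) i

/-- The two conditions on `vPlus` form a linear system whose block triangular matrix is invertible
with `Φ_dep`. Differentiability of `vPlus` in the parameters, which is not assumed, follows from
this formula. -/
theorem eq_resetVelocity {S : MultibodySystem n m p} {e : Fin m ⊕ Fin f ≃ Fin n}
    {e' : Fin k ⊕ Fin l ≃ Fin n}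
    {h : ℝ → (Fin n → ℝ) → (Fin l → ℝ) → (Fin p → ℝ) → (Fin f → ℝ)} {t : ℝ}
    {q vMinus vPlus : Fin n → ℝ} {ρ : Fin p → ℝ} (hdep : IsUnit (S.constrDep e t q ρ).det)
    (hjump : dofVec e vPlus = h t q (dofVec e' vMinus) ρ)
    (hvel : (S.constrQ t q ρ).mulVec vPlus = -S.constrT t q ρ) :
    vPlus = resetVelocity S e e' h (t, q, vMinus, ρ) := by
  have hmul : (S.partitionMatrix e t q ρ).mulVec (vPlus ∘ e) =
      Sum.elim (-S.constrT t q ρ) (h t q (dofVec e' vMinus) ρ) := by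
    rw [MultibodySystem.partitionMatrix, Matrix.fromBlocks_mulVec]
    congr 1
    · rw [← hvel, S.constrQ_mulVec_partition e]
      rfl
    · rw [← hjump, Matrix.zero_mulVec, Matrix.one_mulVec, zero_add]
      rfl
  funext i
  rw [resetVelocity, ← hmul, Matrix.mulVec_mulVec,
    Matrix.nonsing_inv_mul _ (MultibodySystem.isUnit_det_partitionMatrix hdep), Matrix.one_mulVec]
  simp

/-- Rows of a sensitivity matrix annihilated, up to `Φ_ρ`, by `Φ_q`: the dependent rows are
determined by the independent ones. -/
theorem depRows_eq_of_constrQ_mul {S : MultibodySystem n m p} {e : Fin m ⊕ Fin f ≃ Fin n} {t : ℝ}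
    {q : Fin n → ℝ} {ρ : Fin p → ℝ} (hdep : IsUnit (S.constrDep e t q ρ).det)
    {A : Matrix (Fin n) (Fin p) ℝ} (hA : S.constrQ t q ρ * A = -S.constrRho t q ρ) :
    depRows e A = S.matrixR e t q ρ * dofRows e A -
      (S.constrDep e t q ρ)⁻¹ * S.constrRho t q ρ := by
  have hsplit : S.constrQ t q ρ * A =
      S.constrDep e t q ρ * depRows e A + S.constrDof e t q ρ * dofRows e A := by
    ext i j
    simp only [Matrix.mul_apply, Matrix.add_apply]
    rw [← e.sum_comp, Fintype.sum_sum_type]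
    rfl
  have h1 : S.constrDep e t q ρ * depRows e A =
      -S.constrRho t q ρ - S.constrDof e t q ρ * dofRows e A := by
    rw [← hA, hsplit, add_sub_cancel_right]
  calc depRows e A = (S.constrDep e t q ρ)⁻¹ * (S.constrDep e t q ρ * depRows e A) := by
        rw [← Matrix.mul_assoc, Matrix.nonsing_inv_mul _ hdep, Matrix.one_mul]
    _ = _ := by
        rw [h1, MultibodySystem.matrixR, Matrix.mul_sub, Matrix.mul_neg, Matrix.neg_mul,
          Matrix.mul_assoc]
        abel

end Reset

/-! ### Sensitivities of families of orbits -/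

section Sensitivity

open Set
open scoped NNReal

/-- The margin `δ` is needed because a perturbed phase can last longer than the nominal one when the
event time shifts. -/
theorem IsGlobalFlow.exists_eventually_forall_mem_Icc {E : Type*} [NormedAddCommGroup E]
    [NormedSpace ℝ E] {W : E → E} {Φ : ℝ → E → E} {K : ℝ≥0} (hΦ : IsGlobalFlow W Φ)
    (hK : LipschitzWith K W) {N : Set E} (hN : IsOpen N) {x : E} {T : ℝ} (hT : 0 ≤ T)
    (h : ∀ s ∈ Icc 0 T, Φ s x ∈ N) :
    ∃ δ > 0, ∀ᶠ y in 𝓝 x, ∀ s ∈ Icc 0 (T + δ), Φ s y ∈ N := by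
  have h1 : ∀ᶠ s in 𝓝 T, Φ s x ∈ N :=
    (hΦ.continuous_time x).continuousAt.eventually (hN.mem_nhds (h T ⟨hT, le_rfl⟩))
  obtain ⟨ε, hε, hball⟩ := Metric.eventually_nhds_iff.1 h1
  refine ⟨ε / 2, half_pos hε, hΦ.eventually_forall_mem hK isCompact_Icc hN fun s hs => ?_⟩
  rcases le_total s T with hsT | hsT
  · exact h s ⟨hs.1, hsT⟩
  · refine hball ?_
    rw [Real.dist_eq, abs_of_nonneg (sub_nonneg.2 hsT)]
    linarith [hs.2]

variable {n p : ℕ}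

/-- The position component of the extended state. -/
def positionProj (n p : ℕ) : ExtendedState n p →L[ℝ] (Fin n → ℝ) :=
  (ContinuousLinearMap.fst ℝ (Fin n → ℝ) ((Fin n → ℝ) × (Fin p → ℝ))).comp
    (ContinuousLinearMap.snd ℝ ℝ ((Fin n → ℝ) × (Fin n → ℝ) × (Fin p → ℝ)))

theorem positionProj_apply (X : ExtendedState n p) : positionProj n p X = X.2.1 := rfl

variable {W : ExtendedState n p → ExtendedState n p}
  {Φ : ℝ → ExtendedState n p → ExtendedState n p} {K : ℝ≥0} {q : ℝ → (Fin p → ℝ) → (Fin n → ℝ)}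
  {σ : (Fin p → ℝ) → ℝ} {ξ : (Fin p → ℝ) → ExtendedState n p} {σ' : (Fin p → ℝ) →L[ℝ] ℝ}
  {ξ' : (Fin p → ℝ) →L[ℝ] ExtendedState n p} {ρ : Fin p → ℝ} {t : ℝ}

/-- Serves both phases: `σ` is the constant `t₀` before the event and the event time after it. The
term with `σ'` accounts for the shift of the starting time. -/
theorem IsGlobalFlow.hasFDerivAt_position (hΦ : IsGlobalFlow W Φ) (hK : LipschitzWith K W)
    (hW : ContDiff ℝ 1 W) (hσ : HasFDerivAt σ σ' ρ) (hξ : HasFDerivAt ξ ξ' ρ) (ht : σ ρ ≤ t)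
    (hq : ∀ᶠ ρ' in 𝓝 ρ, q t ρ' = (Φ (t - σ ρ') (ξ ρ')).2.1) :
    HasFDerivAt (q t) ((positionProj n p).comp ((fderiv ℝ (Φ (t - σ ρ)) (ξ ρ)).comp ξ' -
      σ'.smulRight (W (Φ (t - σ ρ) (ξ ρ))))) ρ := by
  have h1 := (positionProj n p).hasFDerivAt.comp ρ
    (hΦ.hasFDerivAt_comp hK hW (hσ.const_sub t) hξ (sub_nonneg.2 ht))
  refine (h1.congr_of_eventuallyEq hq).congr_fderiv ?_
  congr 1
  ext b <;> simp [sub_eq_add_neg]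

/-- One-sided limits of the position sensitivity of a family of orbits of a flow. -/
theorem IsGlobalFlow.tendsto_positionSensitivity (hΦ : IsGlobalFlow W Φ) (hK : LipschitzWith K W)
    (hW : ContDiff ℝ 1 W) (hσ : HasFDerivAt σ σ' ρ) (hξ : HasFDerivAt ξ ξ' ρ) (ht : σ ρ ≤ t)
    {l : Filter ℝ} (hl : l ≤ 𝓝[Ici (σ ρ)] t)
    (hq : ∀ᶠ s in l, ∀ᶠ ρ' in 𝓝 ρ, q s ρ' = (Φ (s - σ ρ') (ξ ρ')).2.1) :
    Tendsto (fun s => positionSensitivity q s ρ) l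
      (𝓝 (LinearMap.toMatrix' ((positionProj n p).comp ((fderiv ℝ (Φ (t - σ ρ)) (ξ ρ)).comp ξ' -
        σ'.smulRight (W (Φ (t - σ ρ) (ξ ρ)))) : (Fin p → ℝ) →ₗ[ℝ] (Fin n → ℝ)))) := by
  have hJ : Tendsto (fun s => fderiv ℝ (Φ (s - σ ρ)) (ξ ρ)) l
      (𝓝 (fderiv ℝ (Φ (t - σ ρ)) (ξ ρ))) := by
    have h1 : ContinuousOn (fun s => fderiv ℝ (Φ (s - σ ρ)) (ξ ρ)) (Ici (σ ρ)) :=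
      (hΦ.continuousOn_fderiv hK hW (ξ ρ)).comp (by fun_prop) fun s hs => mem_Ici.2 (sub_nonneg.2 hs)
    exact (h1 t ht).mono_left hl
  have hWl : Tendsto (fun s => W (Φ (s - σ ρ) (ξ ρ))) l (𝓝 (W (Φ (t - σ ρ) (ξ ρ)))) := by
    have h1 : Continuous fun s => W (Φ (s - σ ρ) (ξ ρ)) :=
      hK.continuous.comp ((hΦ.continuous_time _).comp (continuous_id.sub continuous_const))
    exact (h1.tendsto t).mono_left (hl.trans nhdsWithin_le_nhds)
  have hentry : ∀ b, Tendsto (fun s => positionProj n p (fderiv ℝ (Φ (s - σ ρ)) (ξ ρ) (ξ' b) -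
      σ' b • W (Φ (s - σ ρ) (ξ ρ)))) l (𝓝 (positionProj n p (fderiv ℝ (Φ (t - σ ρ)) (ξ ρ) (ξ' b) -
      σ' b • W (Φ (t - σ ρ) (ξ ρ))))) := fun b =>
    ((positionProj n p).continuous.tendsto _).comp
      (((((ContinuousLinearMap.apply ℝ (ExtendedState n p) (ξ' b)).continuous.tendsto _).comp hJ)).sub
        (tendsto_const_nhds.smul hWl))
  refine tendsto_pi_nhds.2 fun i => tendsto_pi_nhds.2 fun j => ?_
  have h2 := tendsto_pi_nhds.1 (hentry (Pi.single j 1)) i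
  rw [LinearMap.toMatrix'_apply]
  refine Tendsto.congr' ?_ h2
  filter_upwards [hq, hl self_mem_nhdsWithin] with s hs hσs
  rw [positionSensitivity, jacobianMatrix_apply,
    (hΦ.hasFDerivAt_position hK hW hσ hξ hσs hs).fderiv]
  rfl

end Sensitivity

/-! ### Neighbouring hybrid trajectories follow the nominal flows -/

section HybridFamily

open Set
open scoped NNReal

variable {n mMinus mPlus fMinus fPlus p : ℕ} {SMinus : MultibodySystem n mMinus p}
  {SPlus : MultibodySystem n mPlus p} {eMinus : Fin mMinus ⊕ Fin fMinus ≃ Fin n}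
  {ePlus : Fin mPlus ⊕ Fin fPlus ≃ Fin n} {r : (Fin n → ℝ) → ℝ}
  {h : ℝ → (Fin n → ℝ) → (Fin fMinus → ℝ) → (Fin p → ℝ) → (Fin fPlus → ℝ)}
  {t₀ tF : ℝ} {q₀ v₀ : (Fin p → ℝ) → (Fin n → ℝ)} {ρ : Fin p → ℝ}
  {q v : ℝ → (Fin p → ℝ) → (Fin n → ℝ)} {τ : (Fin p → ℝ) → ℝ}
  {vMinus vPlus : (Fin p → ℝ) → (Fin n → ℝ)}

/-- Before the event, neighbouring trajectories are orbits of one flow, and the event time is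
differentiable. -/
theorem exists_phaseFlow_before (hr : ContDiff ℝ ∞ r)
    (hq₀ : ContDiffAt ℝ 1 q₀ ρ) (hv₀ : ContDiffAt ℝ 1 v₀ ρ)
    (htraj : ∀ᶠ ρ' in 𝓝 ρ, IsHybridTrajectory SMinus SPlus eMinus ePlus r h t₀ tF
      (q₀ ρ') (v₀ ρ') ρ' (fun t => q t ρ') (fun t => v t ρ') (τ ρ') (vMinus ρ') (vPlus ρ'))
    (hreg : ∀ t ∈ Icc t₀ (τ ρ), IsUnit (SMinus.augmentedMatrix t (q t ρ) ρ).det)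
    (htrans : fderiv ℝ r (q (τ ρ) ρ) (vMinus ρ) ≠ 0) :
    ∃ W Φ K N, IsPhaseFlow SMinus W Φ K N ∧ (τ ρ, q (τ ρ) ρ, vMinus ρ, ρ) ∈ N ∧
      DifferentiableAt ℝ τ ρ ∧ ∀ᶠ ρ' in 𝓝 ρ, ∀ s ∈ Icc t₀ (τ ρ'),
        (s, q s ρ', Function.update (fun t => v t ρ') (τ ρ') (vMinus ρ') s, ρ') =
          Φ (s - t₀) (t₀, q₀ ρ', v₀ ρ', ρ') := by
  have H := htraj.self_of_nhds
  have ht₀ : t₀ < τ ρ := H.event_mem.1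
  obtain ⟨W, Φ, K, N, hS, hnom⟩ := exists_isPhaseFlow H.continuousOn_q_before
    H.continuousOn_before hreg
  have hstart : ∀ ρ', IsHybridTrajectory SMinus SPlus eMinus ePlus r h t₀ tF
      (q₀ ρ') (v₀ ρ') ρ' (fun t => q t ρ') (fun t => v t ρ') (τ ρ') (vMinus ρ') (vPlus ρ') →
      (t₀, q t₀ ρ', Function.update (fun t => v t ρ') (τ ρ') (vMinus ρ') t₀, ρ') =
        ((t₀, q₀ ρ', v₀ ρ', ρ') : ExtendedState n p) := fun ρ' H' => by
    have h1 : q t₀ ρ' = q₀ ρ' := H'.init_q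
    have h2 : v t₀ ρ' = v₀ ρ' := H'.init_v
    rw [Function.update_of_ne H'.event_mem.1.ne, h1, h2]
  set ξ : (Fin p → ℝ) → ExtendedState n p := fun ρ' => (t₀, q₀ ρ', v₀ ρ', ρ') with hξdef
  have hξ : DifferentiableAt ℝ ξ ρ :=
    (differentiableAt_const _).prodMk ((hq₀.differentiableAt one_ne_zero).prodMk
      ((hv₀.differentiableAt one_ne_zero).prodMk differentiableAt_id))
  have hnomΦ := hS.eq_flow H.continuousOn_q_before H.continuousOn_before
    (fun t ht => H.solvesAt_before ht) hnom
  simp only [hstart ρ H] at hnomΦ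
  obtain ⟨δ, hδ, hmem⟩ := hS.flow.exists_eventually_forall_mem_Icc hS.lipschitz hS.isOpen
    (sub_nonneg.2 ht₀.le) (x := ξ ρ) fun s hs => by
      have hs' : s + t₀ ∈ Icc t₀ (τ ρ) := ⟨by linarith [hs.1], by linarith [hs.2]⟩
      have h1 := hnom _ hs'
      rw [hnomΦ _ hs', add_sub_cancel_right] at h1
      exact h1
  -- Nothing is known yet about how far `τ ρ'` lies from `τ ρ`, so the comparison stops at `τ ρ +
  -- δ`. Continuity of `τ` later removes this restriction.
  have hfollow : ∀ᶠ ρ' in 𝓝 ρ, ∀ s ∈ Icc t₀ (τ ρ'), s ≤ τ ρ + δ →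
      (s, q s ρ', Function.update (fun t => v t ρ') (τ ρ') (vMinus ρ') s, ρ') =
        Φ (s - t₀) (ξ ρ') := by
    filter_upwards [htraj, hξ.continuousAt.eventually hmem] with ρ' H' hm s hs hsδ
    have := hS.eq_flow_of_flow_mem (ρ := ρ') (a := t₀) (b := s)
      (H'.continuousOn_q_before.mono (Icc_subset_Icc_right hs.2))
      (H'.continuousOn_before.mono (Icc_subset_Icc_right hs.2))
      (fun u hu => H'.solvesAt_before ⟨hu.1, hu.2.trans_le hs.2⟩)
      (fun u hu => by
        simp only [hstart ρ' H']
        exact hm _ ⟨by linarith [hu.1], by linarith [hu.2]⟩) s ⟨hs.1, le_rfl⟩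
    simpa only [hstart ρ' H'] using this
  have hend : Φ (τ ρ - t₀) (ξ ρ) = (τ ρ, q (τ ρ) ρ, vMinus ρ, ρ) := by
    simpa using (hnomΦ (τ ρ) ⟨ht₀.le, le_rfl⟩).symm
  have hWend : (W (Φ (τ ρ - t₀) (ξ ρ))).2.1 = vMinus ρ := by
    have hN : Φ (τ ρ - t₀) (ξ ρ) ∈ N := by
      rw [← hnomΦ (τ ρ) ⟨ht₀.le, le_rfl⟩]
      exact hnom _ ⟨ht₀.le, le_rfl⟩
    rw [hS.eqOn hN, hend]
    rfl
  have hrd : HasFDerivAt r (fderiv ℝ r (q (τ ρ) ρ)) (positionProj n p (Φ (τ ρ - t₀) (ξ ρ))) := by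
    rw [hend]
    exact (hr.differentiable (by simp) _).hasFDerivAt
  have hξsnd : HasFDerivAt (fun z : ℝ × (Fin p → ℝ) => ξ z.2)
      ((fderiv ℝ ξ ρ).comp (ContinuousLinearMap.snd ℝ ℝ (Fin p → ℝ))) (τ ρ, ρ) :=
    HasFDerivAt.comp (g := ξ) (f := Prod.snd) (τ ρ, ρ) hξ.hasFDerivAt hasFDerivAt_snd
  have hjoint := hS.flow.hasFDerivAt_comp hS.lipschitz hS.contDiff
    (P := ℝ × (Fin p → ℝ)) (ρ := (τ ρ, ρ)) (s := fun z => z.1 - t₀) (ξ := fun z => ξ z.2)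
    (hasFDerivAt_fst.sub_const t₀)
    hξsnd (sub_nonneg.2 ht₀.le)
  have hG := hrd.comp (τ ρ, ρ) ((positionProj n p).hasFDerivAt.comp (τ ρ, ρ) hjoint)
  -- The time derivative of the event function along the flow is the quantity that is nonzero in the
  -- absence of grazing.
  have hG' : HasFDerivAt (fun z : ℝ × (Fin p → ℝ) => r (Φ (z.1 - t₀) (ξ z.2)).2.1)
      ((ContinuousLinearMap.toSpanSingleton ℝ (fderiv ℝ r (q (τ ρ) ρ) (vMinus ρ))).coprod
        (((fderiv ℝ r (q (τ ρ) ρ)).comp (positionProj n p)).comp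
          ((fderiv ℝ (Φ (τ ρ - t₀)) (ξ ρ)).comp (fderiv ℝ ξ ρ)))) (τ ρ, ρ) := by
    refine hG.congr_fderiv ?_
    ext b
    · simp [positionProj_apply, hWend]
    · simp [positionProj_apply]
  have hgc : Continuous fun z : ℝ × ExtendedState n p => r (Φ (z.1 - t₀) z.2).2.1 := by
    have h1 : Continuous fun z : ℝ × ExtendedState n p => Φ (z.1 - t₀) z.2 :=
      (hS.flow.continuous_uncurry hS.lipschitz).comp
        ((continuous_fst.sub continuous_const).prodMk continuous_snd)
    exact hr.continuous.comp ((positionProj n p).continuous.comp h1)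
  have hd : HasDerivAt (fun s => r (Φ (s - t₀) (ξ ρ)).2.1)
      (fderiv ℝ r (q (τ ρ) ρ) (vMinus ρ)) (τ ρ) := by
    have h1 := HasFDerivAt.comp_hasDerivAt (f := fun s => (s, ρ)) (τ ρ) hG'
      ((hasDerivAt_id (τ ρ)).prodMk (hasDerivAt_const (τ ρ) ρ))
    simpa [Function.comp_def] using h1
  have hpos : ∀ {s : ℝ} {ρ' : Fin p → ℝ} {w : Fin n → ℝ},
      (s, q s ρ', w, ρ') = Φ (s - t₀) (ξ ρ') → (Φ (s - t₀) (ξ ρ')).2.1 = q s ρ' :=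
    fun hX => by rw [← hX]
  have hτ : ContinuousAt τ ρ := by
    refine tendsto_firstZero (g := fun s X => r (Φ (s - t₀) X).2.1) hgc hξ.continuousAt hδ ht₀ htrans hd ?_ (fun s hs => ?_) ?_
    · rw [hend]
      exact H.event
    · rw [hpos (hnomΦ s ⟨hs.1, hs.2.le⟩)]
      exact H.no_event_before s hs
    · filter_upwards [htraj, hfollow] with ρ' H' hf
      refine ⟨H'.event_mem.1, fun s hs hsδ => ?_, fun hle => ?_⟩
      · rw [hpos (hf s ⟨hs.1, hs.2.le⟩ hsδ)]
        exact H'.no_event_before s hs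
      · rw [hpos (hf (τ ρ') ⟨H'.event_mem.1.le, le_rfl⟩ hle)]
        exact H'.event
  have hle : ∀ᶠ ρ' in 𝓝 ρ, τ ρ' ≤ τ ρ + δ :=
    (hτ.eventually (gt_mem_nhds (lt_add_of_pos_right (τ ρ) hδ))).mono fun _ => le_of_lt
  refine ⟨W, Φ, K, N, hS, ?_, ?_, ?_⟩
  · simpa using hnom (τ ρ) ⟨ht₀.le, le_rfl⟩
  · refine (hasFDerivAt_of_implicit hG' htrans hτ ?_).differentiableAt
    filter_upwards [htraj, hfollow, hle] with ρ' H' hf hl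
    rw [hpos (hf (τ ρ') ⟨H'.event_mem.1.le, le_rfl⟩ hl)]
    exact H'.event
  · filter_upwards [hfollow, hle] with ρ' hf hl s hs using hf s hs (hs.2.trans hl)

/-- After the event, neighbouring trajectories are orbits of one flow. -/
theorem exists_phaseFlow_after
    (htraj : ∀ᶠ ρ' in 𝓝 ρ, IsHybridTrajectory SMinus SPlus eMinus ePlus r h t₀ tF
      (q₀ ρ') (v₀ ρ') ρ' (fun t => q t ρ') (fun t => v t ρ') (τ ρ') (vMinus ρ') (vPlus ρ'))
    (hreg : ∀ t ∈ Icc (τ ρ) tF, IsUnit (SPlus.augmentedMatrix t (q t ρ) ρ).det)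
    (hτ : ContinuousAt τ ρ)
    (hξ : ContinuousAt (fun ρ' => (τ ρ', q (τ ρ') ρ', vPlus ρ', ρ')) ρ) :
    ∃ W Φ K N, IsPhaseFlow SPlus W Φ K N ∧ (τ ρ, q (τ ρ) ρ, vPlus ρ, ρ) ∈ N ∧
      ∀ᶠ ρ' in 𝓝 ρ, ∀ s ∈ Icc (τ ρ') tF,
        (s, q s ρ', Function.update (fun t => v t ρ') (τ ρ') (vPlus ρ') s, ρ') =
          Φ (s - τ ρ') (τ ρ', q (τ ρ') ρ', vPlus ρ', ρ') := by
  have H := htraj.self_of_nhds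
  have htF : τ ρ < tF := H.event_mem.2
  obtain ⟨W, Φ, K, N, hS, hnom⟩ := exists_isPhaseFlow H.continuousOn_q_after
    H.continuousOn_after hreg
  have hnomΦ := hS.eq_flow H.continuousOn_q_after H.continuousOn_after
    (fun t ht => H.solvesAt_after ht) hnom
  simp only [Function.update_self] at hnomΦ
  obtain ⟨δ, hδ, hmem⟩ := hS.flow.exists_eventually_forall_mem_Icc hS.lipschitz hS.isOpen
    (sub_nonneg.2 htF.le) (x := (τ ρ, q (τ ρ) ρ, vPlus ρ, ρ)) fun s hs => by
      have hs' : s + τ ρ ∈ Icc (τ ρ) tF := ⟨by linarith [hs.1], by linarith [hs.2]⟩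
      have h1 := hnom _ hs'
      rw [hnomΦ _ hs', add_sub_cancel_right] at h1
      exact h1
  refine ⟨W, Φ, K, N, hS, by simpa using hnom (τ ρ) ⟨le_rfl, htF.le⟩, ?_⟩
  filter_upwards [htraj, hξ.eventually hmem,
    hτ.eventually (lt_mem_nhds (sub_lt_self (τ ρ) hδ))] with ρ' H' hm hlt s hs
  have := hS.eq_flow_of_flow_mem (ρ := ρ') H'.continuousOn_q_after H'.continuousOn_after
    (fun u hu => H'.solvesAt_after hu) (fun u hu => by
      simp only [Function.update_self]
      exact hm _ ⟨by linarith [hu.1], by linarith [hu.2]⟩) s hs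
  simpa only [Function.update_self] using this

end HybridFamily

/-! ### The constraint at the event and the jump formulas -/

theorem isOpen_isUnit_det_constrDep {n m f p : ℕ} (S : MultibodySystem n m p)
    (e : Fin m ⊕ Fin f ≃ Fin n) :
    IsOpen {X : ExtendedState n p | IsUnit (S.constrDep e X.1 X.2.1 X.2.2.2).det} := by
  have hdet : Continuous fun X : ExtendedState n p =>
      (S.constrDep e X.1 X.2.1 X.2.2.2).det := by
    refine continuous_iff_continuousAt.2 fun X => ?_
    exact (ContDiffAt.matrix_det fun i j => ((S.contDiff_constrQ_apply i (e (Sum.inl j))).comp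
      MultibodySystem.contDiff_configuration).contDiffAt).continuousAt
  simp only [isUnit_iff_ne_zero]
  exact isOpen_ne.preimage hdet

/-- Differentiating the constraint along a differentiable family of states at which the velocity
constraint holds. -/
theorem MultibodySystem.constrQ_mul_toMatrix {n m p : ℕ} {S : MultibodySystem n m p}
    {τ : (Fin p → ℝ) → ℝ} {x : (Fin p → ℝ) → (Fin n → ℝ)} {ρ : Fin p → ℝ}
    {τ' : (Fin p → ℝ) →L[ℝ] ℝ} {x' : (Fin p → ℝ) →L[ℝ] (Fin n → ℝ)} {w : Fin n → ℝ}
    (hτ : HasFDerivAt τ τ' ρ) (hx : HasFDerivAt x x' ρ)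
    (hzero : ∀ᶠ ρ' in 𝓝 ρ, S.constr (τ ρ') (x ρ') ρ' = 0)
    (hw : (S.constrQ (τ ρ) (x ρ) ρ).mulVec w = -S.constrT (τ ρ) (x ρ) ρ) :
    S.constrQ (τ ρ) (x ρ) ρ *
        LinearMap.toMatrix' ((x' - τ'.smulRight w : (Fin p → ℝ) →L[ℝ] (Fin n → ℝ)) :
          (Fin p → ℝ) →ₗ[ℝ] (Fin n → ℝ)) = -S.constrRho (τ ρ) (x ρ) ρ := by
  have h1 := (S.hasFDerivAt_constrFun (τ ρ, x ρ, ρ)).comp ρ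
    (hτ.prodMk (hx.prodMk (hasFDerivAt_id ρ)))
  have h2 := h1.unique ((hasFDerivAt_const (0 : Fin m → ℝ) ρ).congr_of_eventuallyEq hzero)
  refine Matrix.toLin'.injective (LinearMap.ext fun b => ?_)
  have h3 : fderiv ℝ S.constrFun (τ ρ, x ρ, ρ) (τ' b, x' b, b) = 0 := DFunLike.congr_fun h2 b
  -- The direction `τ' b • (1, w, 0)` is split off because the velocity constraint makes the
  -- derivative of the constraint vanish on it.
  have hsplit : ((τ' b, x' b, b) : ℝ × (Fin n → ℝ) × (Fin p → ℝ)) =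
      τ' b • (1, 0, 0) + τ' b • (0, w, 0) + (0, x' b - τ' b • w, 0) + (0, 0, b) := by
    simp
  rw [hsplit, map_add, map_add, map_add, map_smul, map_smul, ← S.constrT_eq, ← S.constrQ_mulVec,
    ← S.constrQ_mulVec, ← S.constrRho_mulVec, hw, smul_neg, add_neg_cancel, zero_add] at h3
  rw [Matrix.toLin'_apply, Matrix.toLin'_apply, ← Matrix.mulVec_mulVec,
    LinearMap.toMatrix'_mulVec, Matrix.neg_mulVec]
  exact eq_neg_of_add_eq_zero_left h3

theorem theorem6 {n mMinus mPlus fMinus fPlus p : ℕ}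
    -- the equations of motion and constraints before and after the event
    (SMinus : MultibodySystem n mMinus p) (SPlus : MultibodySystem n mPlus p)
    -- the coordinate partitions before and after the event
    (eMinus : Fin mMinus ⊕ Fin fMinus ≃ Fin n) (ePlus : Fin mPlus ⊕ Fin fPlus ≃ Fin n)
    -- the smooth event function and the smooth jump function
    (r : (Fin n → ℝ) → ℝ) (hr : ContDiff ℝ ∞ r)
    (h : ℝ → (Fin n → ℝ) → (Fin fMinus → ℝ) → (Fin p → ℝ) → (Fin fPlus → ℝ))
    (hh : ContDiff ℝ ∞
      (fun x : ℝ × (Fin n → ℝ) × (Fin fMinus → ℝ) × (Fin p → ℝ) =>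
        h x.1 x.2.1 x.2.2.1 x.2.2.2))
    -- the initial conditions, as functions of the parameters
    (t₀ tF : ℝ) (q₀ v₀ : (Fin p → ℝ) → (Fin n → ℝ)) (ρ : Fin p → ℝ)
    (hq₀ : ContDiffAt ℝ 1 q₀ ρ) (hv₀ : ContDiffAt ℝ 1 v₀ ρ)
    -- the hybrid trajectories `q(t, ρ)`, `v(t, ρ)`, with event time `τ(ρ)`, near the nominal `ρ`
    (q v : ℝ → (Fin p → ℝ) → (Fin n → ℝ)) (τ : (Fin p → ℝ) → ℝ)
    (vMinus vPlus : (Fin p → ℝ) → (Fin n → ℝ))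
    (htraj : ∀ᶠ ρ' in 𝓝 ρ, IsHybridTrajectory SMinus SPlus eMinus ePlus r h t₀ tF
      (q₀ ρ') (v₀ ρ') ρ' (fun t => q t ρ') (fun t => v t ρ') (τ ρ') (vMinus ρ') (vPlus ρ'))
    -- the equations of motion are regular along the nominal trajectory
    (hregMinus : ∀ t ∈ Set.Icc t₀ (τ ρ), IsUnit (SMinus.augmentedMatrix t (q t ρ) ρ).det)
    (hregPlus : ∀ t ∈ Set.Icc (τ ρ) tF, IsUnit (SPlus.augmentedMatrix t (q t ρ) ρ).det)
    -- the partitions are admissible at the event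
    (_hdepMinus : IsUnit (SMinus.constrDep eMinus (τ ρ) (q (τ ρ) ρ) ρ).det)
    (hdepPlus : IsUnit (SPlus.constrDep ePlus (τ ρ) (q (τ ρ) ρ) ρ).det)
    -- no grazing
    (htrans : fderiv ℝ r (q (τ ρ) ρ) (vMinus ρ) ≠ 0) :
    DifferentiableAt ℝ τ ρ ∧
    (∀ t ∈ Set.Icc t₀ tF, t ≠ τ ρ → DifferentiableAt ℝ (fun ρ' => q t ρ') ρ) ∧
    ∃ QMinus QPlus : Matrix (Fin n) (Fin p) ℝ,
      Tendsto (fun t => positionSensitivity q t ρ) (𝓝[<] (τ ρ)) (𝓝 QMinus) ∧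
      Tendsto (fun t => positionSensitivity q t ρ) (𝓝[>] (τ ρ)) (𝓝 QPlus) ∧
      dofRows ePlus QPlus = dofRows ePlus QMinus -
        Matrix.vecMulVec (dofVec ePlus (vPlus ρ) - dofVec ePlus (vMinus ρ))
          (timeSensitivity τ ρ) ∧
      depRows ePlus QPlus =
        SPlus.matrixR ePlus (τ ρ) (q (τ ρ) ρ) ρ * dofRows ePlus QPlus -
          (SPlus.constrDep ePlus (τ ρ) (q (τ ρ) ρ) ρ)⁻¹ *
            SPlus.constrRho (τ ρ) (q (τ ρ) ρ) ρ := by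
  have H := htraj.self_of_nhds
  have ht₀ : t₀ < τ ρ := H.event_mem.1
  have htF : τ ρ < tF := H.event_mem.2
  obtain ⟨WB, ΦB, KB, NB, hB, hNB, hτ, hfollowB⟩ :=
    exists_phaseFlow_before hr hq₀ hv₀ htraj hregMinus htrans
  set ξ : (Fin p → ℝ) → ExtendedState n p := fun ρ' => (t₀, q₀ ρ', v₀ ρ', ρ')
  have hξ : HasFDerivAt ξ (fderiv ℝ ξ ρ) ρ := DifferentiableAt.hasFDerivAt
    ((differentiableAt_const _).prodMk ((hq₀.differentiableAt one_ne_zero).prodMk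
      ((hv₀.differentiableAt one_ne_zero).prodMk differentiableAt_id)))
  -- the state right before the event
  have hXB := hB.flow.hasFDerivAt_comp hB.lipschitz hB.contDiff
    (hτ.hasFDerivAt.sub_const t₀) hξ (sub_nonneg.2 ht₀.le)
  have hXBeq : ∀ᶠ ρ' in 𝓝 ρ, ΦB (τ ρ' - t₀) (ξ ρ') = (τ ρ', q (τ ρ') ρ', vMinus ρ', ρ') := by
    filter_upwards [htraj, hfollowB] with ρ' H' hf
    simpa using (hf (τ ρ') ⟨H'.event_mem.1.le, le_rfl⟩).symm
  have hWB : (WB (ΦB (τ ρ - t₀) (ξ ρ))).2.1 = vMinus ρ := by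
    rw [hXBeq.self_of_nhds, hB.eqOn hNB]
    rfl
  -- The first summand is `Q⁻`, the second is `v⁻ τ'`.
  have hqτ : HasFDerivAt (fun ρ' => q (τ ρ') ρ') ((positionProj n p).comp
      ((fderiv ℝ (ΦB (τ ρ - t₀)) (ξ ρ)).comp (fderiv ℝ ξ ρ)) +
        (fderiv ℝ τ ρ).smulRight (vMinus ρ)) ρ := by
    have h1 := (positionProj n p).hasFDerivAt.comp ρ hXB
    refine (h1.congr_of_eventuallyEq ?_).congr_fderiv ?_
    · filter_upwards [hXBeq] with ρ' hρ'
      simp [hρ', positionProj_apply]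
    · ext b
      simp [positionProj_apply, hWB]
  -- the state right after the event
  have hvPlus : DifferentiableAt ℝ vPlus ρ := by
    have hreset : DifferentiableAt ℝ (resetVelocity SPlus ePlus eMinus h)
        (ΦB (τ ρ - t₀) (ξ ρ)) := by
      refine (contDiffAt_resetVelocity hh ?_).differentiableAt (by simp)
      rw [hXBeq.self_of_nhds]
      exact hdepPlus
    have hopen : ∀ᶠ ρ' in 𝓝 ρ, IsUnit (SPlus.constrDep ePlus (τ ρ') (q (τ ρ') ρ') ρ').det := by
      have h1 : ∀ᶠ X in 𝓝 (ΦB (τ ρ - t₀) (ξ ρ)),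
          IsUnit (SPlus.constrDep ePlus X.1 X.2.1 X.2.2.2).det := by
        refine (isOpen_isUnit_det_constrDep SPlus ePlus).mem_nhds ?_
        rw [hXBeq.self_of_nhds]
        exact hdepPlus
      filter_upwards [hXB.continuousAt.eventually h1, hXBeq] with ρ' h2 h3
      rw [h3] at h2
      exact h2
    refine (DifferentiableAt.comp ρ hreset hXB.differentiableAt).congr_of_eventuallyEq ?_
    filter_upwards [htraj, hXBeq, hopen] with ρ' H' h1 h2
    simp only [Function.comp_apply, h1]
    exact eq_resetVelocity h2 H'.jump H'.velocity_constr
  have hξP := hτ.hasFDerivAt.prodMk (hqτ.prodMk (hvPlus.hasFDerivAt.prodMk (hasFDerivAt_id ρ)))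
  obtain ⟨WA, ΦA, KA, NA, hA, hNA, hfollowA⟩ :=
    exists_phaseFlow_after htraj hregPlus hτ.continuousAt hξP.continuousAt
  have hqB : ∀ t, t₀ ≤ t → t < τ ρ → ∀ᶠ ρ' in 𝓝 ρ, q t ρ' = (ΦB (t - t₀) (ξ ρ')).2.1 := by
    intro t ht htτ
    filter_upwards [hfollowB, hτ.continuousAt.eventually (lt_mem_nhds htτ)] with ρ' hf hlt
    rw [← hf t ⟨ht, hlt.le⟩]
  have hqA : ∀ t, τ ρ < t → t ≤ tF → ∀ᶠ ρ' in 𝓝 ρ,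
      q t ρ' = (ΦA (t - τ ρ') (τ ρ', q (τ ρ') ρ', vPlus ρ', ρ')).2.1 := by
    intro t ht htτ
    filter_upwards [hfollowA, hτ.continuousAt.eventually (gt_mem_nhds ht)] with ρ' hf hlt
    rw [← hf t ⟨hlt.le, htτ⟩]
  -- `Q⁺` is taken at elapsed time zero, where the flow has derivative the identity; it is therefore
  -- the derivative of the event position minus `v⁺ τ'`.
  have hΦA0 : ΦA 0 = id := funext hA.flow.zero
  have hWA : (WA (τ ρ, q (τ ρ) ρ, vPlus ρ, ρ)).2.1 = vPlus ρ := by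
    rw [hA.eqOn hNA]
    rfl
  refine ⟨hτ, fun t ht htne => ?_, _, _,
    hB.flow.tendsto_positionSensitivity hB.lipschitz hB.contDiff (hasFDerivAt_const t₀ ρ) hξ
      ht₀.le (l := 𝓝[<] (τ ρ)) ?_ ?_,
    hA.flow.tendsto_positionSensitivity hA.lipschitz hA.contDiff hτ.hasFDerivAt hξP
      le_rfl (l := 𝓝[>] (τ ρ)) (nhdsWithin_mono _ Set.Ioi_subset_Ici_self) ?_, ?_, ?_⟩
  · rcases htne.lt_or_gt with hlt | hlt
    · exact (hB.flow.hasFDerivAt_position hB.lipschitz hB.contDiff (hasFDerivAt_const t₀ ρ) hξ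
        ht.1 (hqB t ht.1 hlt)).differentiableAt
    · exact (hA.flow.hasFDerivAt_position hA.lipschitz hA.contDiff hτ.hasFDerivAt hξP
        hlt.le (hqA t hlt ht.2)).differentiableAt
  · rw [nhdsWithin_eq_nhds.2 (Ici_mem_nhds ht₀)]
    exact nhdsWithin_le_nhds
  · filter_upwards [Ioo_mem_nhdsLT ht₀] with s hs using hqB s hs.1.le hs.2
  · filter_upwards [Ioo_mem_nhdsGT htF] with s hs using hqA s hs.1 hs.2.le
  · ext i j
    simp [dofRows, Matrix.vecMulVec_apply, LinearMap.toMatrix'_apply, positionProj_apply,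
      hΦA0, hWA, dofVec, timeSensitivity]
    ring
  · refine depRows_eq_of_constrQ_mul hdepPlus ?_
    -- With `w` the velocity `v⁺`, the matrix in this identity is exactly `Q⁺`.
    have hkey := MultibodySystem.constrQ_mul_toMatrix (S := SPlus) hτ.hasFDerivAt hqτ
      (htraj.mono fun ρ' H' => H'.constr_after) H.velocity_constr
    rw [← hkey]
    congr 2
    ext b i
    simp [positionProj_apply, hΦA0, hWA]
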